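/- **Setting.** Let $\mathcal W$ be a closed convex subset of a Euclidean (more generally, real Hilbert) space with $\|\mathbf w-\mathbf w'\|\le D$ for all $\mathbf w,\mathbf w'\in\mathcal W$, let $T\in\mathbb N$, and let $f_1,\dots,f_T:\mathcal W\to\mathbb R$ be convex and differentiable on $\mathcal W$ with $\|\nabla f_t(\mathbf w)\|\le G$ for all $\mathbf w\in\mathcal W$ and $t\in[T]$, where $G,D>0$. Let $\lambda\ge 0$ and assume $T\ge\max(\sqrt\lambda\,\log_2T,\;e)$. Here $\log$ is the natural logarithm and $\Pi_{\mathcal W}$ the Euclidean projection onto $\mathcal W$. **DNP-cu** (Discounted-Normal-Predictor with conservative updating) with parameters $n,Z>0$. Let $\operatorname{erf}(x)=\frac{2}{\sqrt\pi}\int_0^xe^{-v^2}dv$, $\tilde g(x)=\sqrt{n/8}\,Z\operatorname{erf}\!\big(x/\sqrt{8n}\big)e^{x^2/(16n)}$, $g(x)=\min(1,\max(0,\tilde g(x)))$, $U(n)=\tilde g^{-1}(1)$ and $\rho=1-1/n$. Start with $x_1=0$. In round $t$ predict $g(x_t)$, receive $b_t\in\mathbb R$, and set $x_{t+1}=\rho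 x_t+b_t$ if $x_t\in[0,U(n)]$, or $x_t<0<b_t$, or ($x_t>U(n)$ and $b_t<0$); otherwise set $x_{t+1}=\rho x_t$. **Combiner** with parameters $M,n,Z$ for two learners with outputs $\mathbf w_t^1,\mathbf w_t^2$. It outputs $(1-w_t)\mathbf w^1_t+w_t\mathbf w^2_t$, where $w_t$ is the prediction in round $t$ of DNP-cu with parameters $n,Z$ run on the bits $\ell_t/\max(\sqrt\lambda,1)$, with $$\ell_t=\frac{\big(f_t(\mathbf w^1_t)+\lambda G\|\mathbf w_t^1-\mathbf w_{t+1}^1\|\big)-\big(f_t(\mathbf w^2_t)+\lambda G\|\mathbf w_t^2-\mathbf w_{t+1}^2\|\big)}{(1+M)GD}.$$ **Smoothed OGD** with parameters $K\ge 1$, $M$, $Z$. For $i=1,\dots,K$ put $n^{(i)}=T2^{1-i}$, and let $\mathcal A^i$ be projected online gradient descent $\mathbf w_{t+1}=\Pi_{\mathcal W}[\mathbf w_t-\eta^{(i)}\nabla f_t(\mathbf w_t)]$ with step size $\eta^{(i)}=\frac DG\sqrt{\frac1{(1+2\lambda)n^{(i)}}}$ and an arbitrary starting point in $\mathcal W$.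 Let $\mathcal B^1=\mathcal A^1$, and for $i\ge2$ let $\mathcal B^i$ be Combiner with parameters $M,n^{(i)},Z$ applied to $\mathcal B^{i-1}$ (first learner) and $\mathcal A^i$ (second learner). The output $\mathbf w_t$ is that of $\mathcal B^K$. **Theorem.** Run smoothed OGD with $M=2$, $Z=1/T$ and $$K=\max\Big(\Big\lfloor\log_2\frac{T}{32\max(\lambda,1)\log(1/Z)}\Big\rfloor,\,0\Big)+1 .$$ Then for all $1\le r\le s\le T$, with $\tau=s-r+1$, and for all comparators $\mathbf u_r,\dots,\mathbf u_s\in\mathcal W$ and any further point $\mathbf u_{s+1}$ (for instance $\mathbf u_{s+1}=\mathbf u_s$), with path-length $P_{r,s}=\sum_{t=r}^s\|\mathbf u_t-\mathbf u_{t+1}\|$, $$\sum_{t=r}^s\big(f_t(\mathbf w_t)+\lambda G\|\mathbf w_t-\mathbf w_{t+1}\|-f_t(\mathbf u_t)\big)\le 2GD\sqrt{(1+\lambda)\tau\Big(1+\frac{2P_{r,s}}{D}\Big)}+120\,GD\max(\sqrt\lambda,1)\sqrt{\tau\Big(1+\frac{2P_{r,s}}{D}\Big)\log T}.$$ Moreover,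 the right-hand side is at most $C\sqrt{(1+\lambda)\,\tau\,(1+P_{r,s})\log T}$, where $C$ depends only on $G$ and $D$. -/

import Mathlib

noncomputable section

namespace SmoothedOCO

/-! Rounds are numbered `1, 2, 3, …`; sequences are functions on `ℕ` whose value at `0` is not used
by any of the algorithms (the recursions below repeat the initial value there). -/

/-- The error function `erf x = (2 / √π) ∫₀ˣ exp (-s²) ds`. -/
def erf (x : ℝ) : ℝ := 2 / √Real.pi * ∫ s in (0 : ℝ)..x, Real.exp (-s ^ 2)

/-- The unclipped confidence function `g̃` with parameters `n` and `Z`. -/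
def gTilde (n Z x : ℝ) : ℝ :=
  √(n / 8) * Z * erf (x / √(8 * n)) * Real.exp (x ^ 2 / (16 * n))

/-- The confidence function `g`, the projection of `g̃` onto `[0, 1]`. -/
def confidence (n Z x : ℝ) : ℝ := max 0 (min 1 (gTilde n Z x))

/-- The threshold `U(n) = g̃⁻¹(1)`. For `n, Z > 0` the function `g̃` is a bijection of `ℝ`, being
continuous, strictly increasing, and unbounded in both directions. -/
def threshold (n Z : ℝ) : ℝ := Function.invFun (gTilde n Z) 1

open Classical in
/-- One update `x_t ↦ x_{t+1}` of the deviation in Discounted-Normal-Predictor with conservative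
updating, on receiving the bit `b`. -/
def dnpStep (n Z x b : ℝ) : ℝ :=
  if (0 ≤ x ∧ x ≤ threshold n Z) ∨ (x < 0 ∧ 0 < b) ∨ (threshold n Z < x ∧ b < 0) then
    (1 - 1 / n) * x + b
  else
    (1 - 1 / n) * x

/-- The deviation `x_t` of Discounted-Normal-Predictor with conservative updating run on the bits
`b 1, b 2, …`, started at `x_1 = 0`. -/
def dnpDeviation (n Z : ℝ) (b : ℕ → ℝ) : ℕ → ℝ
  | 0 => 0
  | t + 1 => if t = 0 then 0 else dnpStep n Z (dnpDeviation n Z b t) (b t)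

/-- The prediction `g(x_t)` of Discounted-Normal-Predictor with conservative updating. -/
def dnpPrediction (n Z : ℝ) (b : ℕ → ℝ) (t : ℕ) : ℝ :=
  confidence n Z (dnpDeviation n Z b t)

variable {E : Type*} [NormedAddCommGroup E] [InnerProductSpace ℝ E]

/-- Euclidean projection onto `W`: a point of `W` at minimal distance from `x`. -/
def proj (W : Set E) (x : E) : E :=
  @Classical.epsilon E ⟨x⟩ fun p => p ∈ W ∧ ‖x - p‖ = ⨅ w : W, ‖x - w‖

/-- On a nonempty closed convex set of a complete space the projection is a nearest point. -/
theorem proj_spec [CompleteSpace E] {W : Set E} (hne : W.Nonempty) (hcl : IsClosed W)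
    (hW : Convex ℝ W) (x : E) : proj W x ∈ W ∧ ‖x - proj W x‖ = ⨅ w : W, ‖x - w‖ := by
  obtain ⟨p, hp⟩ := exists_norm_eq_iInf_of_complete_convex hne hcl.isComplete hW x
  exact @Classical.epsilon_spec_aux E ⟨x⟩ (fun p => p ∈ W ∧ ‖x - p‖ = ⨅ w : W, ‖x - w‖) ⟨p, hp⟩

/-- Projected online gradient descent on `W` with constant step size `η`, started at `x₁`;
`grad t w` is the gradient of the `t`-th loss at `w`. -/
def ogd (W : Set E) (grad : ℕ → E → E) (η : ℝ) (x₁ : E) : ℕ → E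
  | 0 => x₁
  | t + 1 =>
    if t = 0 then x₁
    else proj W (ogd W grad η x₁ t - η • grad t (ogd W grad η x₁ t))

/-- Total loss `f_t(w_t) + lam * G * ‖w_t - w_{t+1}‖` of the learner `w` in round `t`. -/
def totalLoss (f : ℕ → E → ℝ) (lam G : ℝ) (w : ℕ → E) (t : ℕ) : ℝ :=
  f t (w t) + lam * G * ‖w t - w (t + 1)‖

/-- The normalized loss difference `ℓ_t` of two learners `w₁` and `w₂`. -/
def lossGap (f : ℕ → E → ℝ) (lam G D M : ℝ) (w₁ w₂ : ℕ → E) (t : ℕ) : ℝ :=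
  (totalLoss f lam G w₁ t - totalLoss f lam G w₂ t) / ((1 + M) * G * D)

/-- The weight given to the second learner: the prediction of Discounted-Normal-Predictor with
conservative updating run on the scaled bits `ℓ_t / max (√lam) 1`. The weight in round `t` only
depends on `ℓ_1, …, ℓ_{t-1}`. -/
def combinerWeight (f : ℕ → E → ℝ) (lam G D M n Z : ℝ) (w₁ w₂ : ℕ → E) (t : ℕ) : ℝ :=
  dnpPrediction n Z (fun j => lossGap f lam G D M w₁ w₂ j / max (√lam) 1) t

/-- Combiner: aggregates the learners `w₁` and `w₂` by a convex combination. -/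
def combiner (f : ℕ → E → ℝ) (lam G D M n Z : ℝ) (w₁ w₂ : ℕ → E) (t : ℕ) : E :=
  (1 - combinerWeight f lam G D M n Z w₁ w₂ t) • w₁ t +
    combinerWeight f lam G D M n Z w₁ w₂ t • w₂ t

/-- The scale `n^{(i)} = T 2^{1-i}`. -/
def scale (T i : ℕ) : ℝ := (T : ℝ) * 2 ^ (1 - (i : ℤ))

/-- The step size `η^{(i)} = (D / G) √(1 / ((1 + 2 lam) n^{(i)}))`. -/
def stepSize (lam G D : ℝ) (T i : ℕ) : ℝ := D / G * √(1 / ((1 + 2 * lam) * scale T i))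

/-- The `i`-th expert `𝒜^i`: online gradient descent with step size `η^{(i)}`, started at `x₁ i`. -/
def expert (W : Set E) (grad : ℕ → E → E) (lam G D : ℝ) (T : ℕ) (x₁ : ℕ → E) (i : ℕ) : ℕ → E :=
  ogd W grad (stepSize lam G D T i) (x₁ i)

/-- Smoothed online gradient descent with `K` experts: the output of `ℬ^K`, where `ℬ^1 = 𝒜^1` and
`ℬ^i` combines `ℬ^{i-1}` with `𝒜^i` using the parameters `M`, `n^{(i)}`, `Z`.
(Used with `K ≥ 1`; the value for `K = 0` is a dummy.) -/
def smoothedOGD (W : Set E) (f : ℕ → E → ℝ) (grad : ℕ → E → E) (lam G D M Z : ℝ) (T : ℕ)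
    (x₁ : ℕ → E) : ℕ → ℕ → E
  | 0 => expert W grad lam G D T x₁ 1
  | K + 1 =>
    if K = 0 then expert W grad lam G D T x₁ 1
    else combiner f lam G D M (scale T (K + 1)) Z
      (smoothedOGD W f grad lam G D M Z T x₁ K) (expert W grad lam G D T x₁ (K + 1))

/-- The number of experts, `K = ⌊log₂ (T / (32 max(lam, 1) log (1 / Z)))⌋ + 1`. The floor `⌊·⌋₊` is
the usual one for nonnegative arguments and is `0` for negative ones, so that `K ≥ 1` always. -/
def numExperts (lam Z : ℝ) (T : ℕ) : ℕ :=
  ⌊Real.logb 2 ((T : ℝ) / (32 * max lam 1 * Real.log (1 / Z)))⌋₊ + 1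

/-- Path-length `P_{r,s} = ∑_{t=r}^s ‖u_t - u_{t+1}‖`. -/
def pathLength (u : ℕ → E) (r s : ℕ) : ℝ := ∑ t ∈ Finset.Icc r s, ‖u t - u (t + 1)‖

/-- Dynamic regret with switching cost of the learner `w` against the comparators `u` over the
interval `[r, s]`. -/
def dynamicRegret (f : ℕ → E → ℝ) (lam G : ℝ) (w u : ℕ → E) (r s : ℕ) : ℝ :=
  ∑ t ∈ Finset.Icc r s, (f t (w t) + lam * G * ‖w t - w (t + 1)‖ - f t (u t))

/-- The explicit bound, as a function of the interval length `τ` and the path-length `P`. -/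
def regretBound (lam G D τ P : ℝ) (T : ℕ) : ℝ :=
  2 * G * D * √((1 + lam) * τ * (1 + 2 * P / D)) +
    120 * G * D * max (√lam) 1 * √(τ * (1 + 2 * P / D) * Real.log T)

end SmoothedOCO

end

/-! ### The confidence function: differential equation, slope growth and threshold. -/

namespace SmoothedOCO

/-! Each expert is gradient descent tuned to one scale n. On an interval of length τ its regret is
of order GD√(1+λ)(√n·p + τ/√n) with p = 1 + 2P/D, so the right scale is τ/p, and the dyadic scales
contain one within a factor of two. It remains to show that the output keeps up with whichever
expert is right, at an extra cost of order GD·max(√λ,1)·√(τ p log T), switching included.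

Combining two learners is a prediction problem for the weight g(x_t): by convexity the combined
total loss is at most the weighted total losses plus λGD times the change of the weight. Let Φ be
the primitive of g, L = log(1/Z), and m a bound for the bits. The slope of g is controlled by
x·g/(8n) + Z/7, so both the second-order error of Φ along a step and the change of g are controlled
by x·g/n and Z. Discounting lowers Φ by x·g/n to first order, which pays for both, up to Z per round
(`DnpParams.potential_step`). Conservative updating keeps x_t in [-m, U+m] with U = O(√(nL)).
Telescoping thus gives, on every interval, regret O(√(nL)) + τZ against the weight 0, and an
additional O(τ√(L/n)) against the weight 1 (`DnpParams.dnp_round`).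

With m = 1/max(√λ,1), the change of weight that this argument can absorb covers the true switching
price because λ ≤ max(√λ,1)². To follow expert i, compare with weight 1 at level i and with weight 0
at all later levels; the later costs √(n^{(j)}L) form a geometric series
(`smoothedOGD_regret_le_expert`). All this needs the normalized loss gaps to be at most 1, that is,
every level must move slowly, which is a separate induction (`smoothedOGD_slow_aux`). When τ/p is
below the smallest scale, which is O(max(λ,1) log T), a linear regret bound suffices. -/

theorem hasDerivAt_erf (x : ℝ) : HasDerivAt erf (2 / √Real.pi * Real.exp (-x ^ 2)) x := by
  have hc : Continuous fun s : ℝ => Real.exp (-s ^ 2) := by fun_prop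
  exact (intervalIntegral.integral_hasDerivAt_right (hc.intervalIntegrable _ _)
    hc.stronglyMeasurable.stronglyMeasurableAtFilter hc.continuousAt).const_mul _

theorem erf_zero : erf 0 = 0 := by simp [erf]

/-- Differentiating the factor e^{x²/(16n)} reproduces g̃ times x/(8n), and the error function
contributes only O(Z). A slope of size x·g̃/n is exactly what the discount can pay for. -/
theorem hasDerivAt_gTilde {n : ℝ} (hn : 0 < n) (Z x : ℝ) :
    HasDerivAt (gTilde n Z)
      (x / (8 * n) * gTilde n Z x + Z / (4 * √Real.pi) * Real.exp (-(x ^ 2 / (16 * n)))) x := by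
  have h1 : HasDerivAt (fun y : ℝ => y / √(8 * n)) (1 / √(8 * n)) x :=
    (hasDerivAt_id x).div_const _
  have h2 := (hasDerivAt_erf (x / √(8 * n))).comp x h1
  have h3 : HasDerivAt (fun y : ℝ => Real.exp (y ^ 2 / (16 * n)))
      (Real.exp (x ^ 2 / (16 * n)) * (2 * x / (16 * n))) x := by
    have := ((hasDerivAt_pow 2 x).div_const (16 * n)).exp
    simpa using this
  have h4 := (h2.const_mul (√(n / 8) * Z)).mul h3
  refine h4.congr_deriv ?_
  have e1 : √(n / 8) * (1 / √(8 * n)) = 1 / 8 := by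
    rw [mul_one_div, ← Real.sqrt_div (by positivity), show n / 8 / (8 * n) = (1 / 8) ^ 2 by
      field_simp, Real.sqrt_sq (by norm_num)]
  have e2 : (x / √(8 * n)) ^ 2 = x ^ 2 / (8 * n) := by
    rw [div_pow, Real.sq_sqrt (by positivity)]
  have e3 : Real.exp (-(x ^ 2 / (8 * n))) * Real.exp (x ^ 2 / (16 * n))
      = Real.exp (-(x ^ 2 / (16 * n))) := by
    rw [← Real.exp_add]
    congr 1
    field_simp
    ring
  have e4 : (2 * x / (16 * n)) = x / (8 * n) := by
    field_simp
    ring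
  simp only [Function.comp_apply]
  rw [e4, e2, ← e3]
  unfold gTilde
  linear_combination (2 * Z / √Real.pi * (Real.exp (-(x ^ 2 / (8 * n))) *
    Real.exp (x ^ 2 / (16 * n)))) * e1

theorem gTilde_zero (n Z : ℝ) : gTilde n Z 0 = 0 := by simp [gTilde, erf_zero]

theorem strictMono_erf : StrictMono erf := by
  refine strictMono_of_deriv_pos fun x => ?_
  rw [(hasDerivAt_erf x).deriv]
  positivity

theorem gTilde_nonneg {n Z x : ℝ} (hZ : 0 < Z) (hx : 0 ≤ x) : 0 ≤ gTilde n Z x := by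
  have : 0 ≤ erf (x / √(8 * n)) := by
    rw [← erf_zero]
    exact strictMono_erf.monotone (by positivity)
  unfold gTilde
  positivity

theorem gTilde_nonpos {n Z x : ℝ} (hZ : 0 < Z) (hx : x ≤ 0) : gTilde n Z x ≤ 0 := by
  have : erf (x / √(8 * n)) ≤ 0 := by
    rw [← erf_zero]
    exact strictMono_erf.monotone (div_nonpos_of_nonpos_of_nonneg hx (by positivity))
  unfold gTilde
  refine mul_nonpos_of_nonpos_of_nonneg (mul_nonpos_of_nonneg_of_nonpos ?_ this) ?_ <;> positivity

theorem strictMono_gTilde {n Z : ℝ} (hn : 0 < n) (hZ : 0 < Z) : StrictMono (gTilde n Z) := by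
  refine strictMono_of_deriv_pos fun x => ?_
  rw [(hasDerivAt_gTilde hn Z x).deriv]
  have : 0 ≤ x * gTilde n Z x := by
    rcases le_total 0 x with h | h
    · exact mul_nonneg h (gTilde_nonneg hZ h)
    · exact mul_nonneg_of_nonpos_of_nonpos h (gTilde_nonpos hZ h)
  have e : x / (8 * n) * gTilde n Z x = x * gTilde n Z x / (8 * n) := by ring
  rw [e]
  positivity

theorem continuous_gTilde {n : ℝ} (hn : 0 < n) (Z : ℝ) : Continuous (gTilde n Z) :=
  continuous_iff_continuousAt.2 fun x => (hasDerivAt_gTilde hn Z x).continuousAt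

/-- An upper bound for the slope of `gTilde n Z` on the nonnegative half-line. -/
noncomputable def slopeBound (n Z x : ℝ) : ℝ := x / (8 * n) * gTilde n Z x + Z / 7

theorem deriv_gTilde_le {n Z : ℝ} (hn : 0 < n) (hZ : 0 < Z) (x : ℝ) :
    x / (8 * n) * gTilde n Z x + Z / (4 * √Real.pi) * Real.exp (-(x ^ 2 / (16 * n)))
      ≤ slopeBound n Z x := by
  have h1 : (7 : ℝ) ≤ 4 * √Real.pi := by
    have : (7 / 4 : ℝ) ≤ √Real.pi := Real.le_sqrt_of_sq_le (by
      have := Real.pi_gt_d2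
      norm_num at this ⊢
      linarith)
    linarith
  have h2 : Z / (4 * √Real.pi) ≤ Z / 7 := by gcongr
  have h3 : Real.exp (-(x ^ 2 / (16 * n))) ≤ 1 := Real.exp_le_one_iff.2 (by
    have : 0 ≤ x ^ 2 / (16 * n) := by positivity
    linarith)
  have h4 : Z / (4 * √Real.pi) * Real.exp (-(x ^ 2 / (16 * n))) ≤ Z / 7 * 1 := by gcongr
  unfold slopeBound
  linarith

theorem slopeBound_pos {n Z x : ℝ} (hn : 0 < n) (hZ : 0 < Z) (hx : 0 ≤ x) :
    0 < slopeBound n Z x := by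
  have := gTilde_nonneg (n := n) hZ hx
  unfold slopeBound
  positivity

theorem slopeBound_le {n Z x y : ℝ} (hn : 0 < n) (hZ : 0 < Z) (hx : 0 ≤ x) (hxy : x ≤ y) :
    slopeBound n Z x ≤ slopeBound n Z y := by
  have h1 := gTilde_nonneg (n := n) hZ hx
  have h2 := (strictMono_gTilde hn hZ).monotone hxy
  have : 0 ≤ y := hx.trans hxy
  unfold slopeBound
  gcongr

theorem gTilde_sub_le {n Z x y : ℝ} (hn : 0 < n) (hZ : 0 < Z) (hx : 0 ≤ x) (hxy : x ≤ y) :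
    gTilde n Z y - gTilde n Z x ≤ slopeBound n Z y * (y - x) := by
  refine (convex_Icc x y).image_sub_le_mul_sub_of_deriv_le (continuous_gTilde hn Z).continuousOn
    (fun z _ => (hasDerivAt_gTilde hn Z z).differentiableAt.differentiableWithinAt)
    (fun z hz => ?_) x (Set.left_mem_Icc.2 hxy) y (Set.right_mem_Icc.2 hxy) hxy
  rw [interior_Icc] at hz
  rw [(hasDerivAt_gTilde hn Z z).deriv]
  exact (deriv_gTilde_le hn hZ z).trans (slopeBound_le hn hZ (hx.trans hz.1.le) hz.2.le)

/-- A Grönwall argument: since g̃' ≤ `slopeBound` and g̃(z) ≤ z·`slopeBound`(z), the logarithmic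
derivative of `slopeBound` is at most 2z/(8n), so its product with e^{-z²/(8n)} decreases. -/
theorem slopeBound_growth {n Z x y : ℝ} (hn : 0 < n) (hZ : 0 < Z) (hx : 0 ≤ x) (hxy : x ≤ y) :
    slopeBound n Z y ≤ slopeBound n Z x * Real.exp ((y ^ 2 - x ^ 2) / (8 * n)) := by
  have hd : ∀ z, HasDerivAt (fun z => slopeBound n Z z * Real.exp (-(z ^ 2 / (8 * n))))
      ((1 / (8 * n) * gTilde n Z z + z / (8 * n) * (z / (8 * n) * gTilde n Z z +
        Z / (4 * √Real.pi) * Real.exp (-(z ^ 2 / (16 * n))))) * Real.exp (-(z ^ 2 / (8 * n))) +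
        slopeBound n Z z * (Real.exp (-(z ^ 2 / (8 * n))) * -(2 * z / (8 * n)))) z := by
    intro z
    have h1 : HasDerivAt (slopeBound n Z) (1 / (8 * n) * gTilde n Z z + z / (8 * n) *
        (z / (8 * n) * gTilde n Z z + Z / (4 * √Real.pi) * Real.exp (-(z ^ 2 / (16 * n))))) z :=
      (((hasDerivAt_id z).div_const (8 * n)).mul (hasDerivAt_gTilde hn Z z)).add_const (Z / 7)
    have h2 : HasDerivAt (fun z : ℝ => Real.exp (-(z ^ 2 / (8 * n))))
        (Real.exp (-(z ^ 2 / (8 * n))) * -(2 * z / (8 * n))) z := by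
      simpa using ((hasDerivAt_pow 2 z).div_const (8 * n)).neg.exp
    exact h1.mul h2
  have hanti : AntitoneOn (fun z => slopeBound n Z z * Real.exp (-(z ^ 2 / (8 * n))))
      (Set.Ici 0) := by
    refine antitoneOn_of_deriv_nonpos (convex_Ici 0)
      (fun z _ => (hd z).continuousAt.continuousWithinAt)
      (fun z _ => (hd z).differentiableAt.differentiableWithinAt) fun z hz => ?_
    rw [interior_Ici] at hz
    have hz0 : 0 ≤ z := le_of_lt hz
    rw [(hd z).deriv]
    have h1 := deriv_gTilde_le hn hZ z
    have h2 := gTilde_sub_le hn hZ le_rfl hz0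
    rw [gTilde_zero, sub_zero, sub_zero] at h2
    have h3 : 1 / (8 * n) * gTilde n Z z ≤ 1 / (8 * n) * (slopeBound n Z z * z) := by gcongr
    have h4 := mul_le_mul_of_nonneg_left h1 (show 0 ≤ z / (8 * n) by positivity)
    have h5 : 1 / (8 * n) * (slopeBound n Z z * z) + z / (8 * n) * slopeBound n Z z
      = slopeBound n Z z * (2 * z / (8 * n)) := by ring
    have h6 := mul_le_mul_of_nonneg_right (add_le_add h3 h4)
      (Real.exp_pos (-(z ^ 2 / (8 * n)))).le
    rw [h5] at h6
    linarith
  have := hanti (Set.mem_Ici.2 hx) (Set.mem_Ici.2 (hx.trans hxy)) hxy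
  simp only at this
  have h7 := mul_le_mul_of_nonneg_right this (Real.exp_pos (y ^ 2 / (8 * n))).le
  rw [mul_assoc, ← Real.exp_add, mul_assoc, ← Real.exp_add] at h7
  simpa [sub_div, neg_add_eq_sub] using h7

theorem half_le_erf_one : 1 / 2 ≤ erf 1 := by
  have h1 : (2 / 3 : ℝ) ≤ ∫ s in (0 : ℝ)..1, Real.exp (-s ^ 2) := by
    have : ∫ s in (0 : ℝ)..1, (1 - s ^ 2) = 2 / 3 := by
      rw [intervalIntegral.integral_sub (by simp) (by simp), integral_pow]
      norm_num
    rw [← this]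
    refine intervalIntegral.integral_mono_on (by norm_num)
      (Continuous.intervalIntegrable (by fun_prop) _ _)
      (Continuous.intervalIntegrable (by fun_prop) _ _) fun s _ => ?_
    have := Real.add_one_le_exp (-s ^ 2)
    linarith
  have h2 : √Real.pi ≤ 2 := Real.sqrt_le_iff.2 ⟨by norm_num, by linarith [Real.pi_le_four]⟩
  have h3 : (1 : ℝ) ≤ 2 / √Real.pi := (one_le_div (by positivity)).2 h2
  unfold erf
  nlinarith

/-- At this point the exponential factor equals 1/Z and cancels Z; what remains is √(n/8) ≥ 2 times
a value of erf that is at least 1/2. -/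
theorem one_le_gTilde {n Z : ℝ} (hZ : 0 < Z) (hL : 1 ≤ Real.log (1 / Z)) (hn : 32 ≤ n) :
    1 ≤ gTilde n Z (4 * √(n * Real.log (1 / Z))) := by
  set L := Real.log (1 / Z)
  have hn0 : 0 < n := by linarith
  have e1 : (4 * √(n * L)) ^ 2 / (16 * n) = L := by
    rw [mul_pow, Real.sq_sqrt (by positivity)]
    field_simp
    norm_num
  have e2 : Real.exp L = 1 / Z := Real.exp_log (by positivity)
  have h1 : (1 : ℝ) ≤ 4 * √(n * L) / √(8 * n) := by
    rw [one_le_div (by positivity)]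
    have : (4 : ℝ) = √16 := by
      rw [show (16 : ℝ) = 4 ^ 2 by norm_num, Real.sqrt_sq (by norm_num)]
    rw [this, ← Real.sqrt_mul (by norm_num)]
    exact Real.sqrt_le_sqrt (by nlinarith)
  have h2 := half_le_erf_one.trans (strictMono_erf.monotone h1)
  have h3 : 2 ≤ √(n / 8) := Real.le_sqrt_of_sq_le (by linarith)
  unfold gTilde
  rw [e1, e2]
  have : √(n / 8) * Z * erf (4 * √(n * L) / √(8 * n)) * (1 / Z)
      = √(n / 8) * erf (4 * √(n * L) / √(8 * n)) := by field_simp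
  rw [this]
  nlinarith

theorem gTilde_threshold {n Z : ℝ} (hZ : 0 < Z) (hL : 1 ≤ Real.log (1 / Z)) (hn : 32 ≤ n) :
    gTilde n Z (threshold n Z) = 1 := by
  have hn0 : 0 < n := by linarith
  have h := intermediate_value_Icc (show (0 : ℝ) ≤ 4 * √(n * Real.log (1 / Z)) by positivity)
    (continuous_gTilde hn0 Z).continuousOn
  obtain ⟨x, -, hx⟩ := h ⟨by rw [gTilde_zero]; exact zero_le_one, one_le_gTilde hZ hL hn⟩
  exact Function.invFun_eq ⟨x, hx⟩

theorem threshold_le {n Z : ℝ} (hZ : 0 < Z) (hL : 1 ≤ Real.log (1 / Z)) (hn : 32 ≤ n) :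
    threshold n Z ≤ 4 * √(n * Real.log (1 / Z)) := by
  rw [← (strictMono_gTilde (by linarith) hZ).le_iff_le, gTilde_threshold hZ hL hn]
  exact one_le_gTilde hZ hL hn

theorem threshold_pos {n Z : ℝ} (hZ : 0 < Z) (hL : 1 ≤ Real.log (1 / Z)) (hn : 32 ≤ n) :
    0 < threshold n Z := by
  rw [← (strictMono_gTilde (by linarith) hZ).lt_iff_lt, gTilde_threshold hZ hL hn, gTilde_zero]
  exact zero_lt_one

/-- Clipping the argument to [0, U] instead of the value lets the slope estimates for g̃ be applied
on a bounded range. -/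
theorem confidence_eq_gTilde_clip {n Z : ℝ} (hn : 0 < n) (hZ : 0 < Z)
    (hU : gTilde n Z (threshold n Z) = 1) (x : ℝ) :
    confidence n Z x = gTilde n Z (max 0 (min (threshold n Z) x)) := by
  have hm := (strictMono_gTilde hn hZ).monotone
  rw [hm.map_max, hm.map_min, hU, gTilde_zero, confidence]

theorem confidence_nonneg (n Z x : ℝ) : 0 ≤ confidence n Z x := le_max_left _ _

theorem confidence_le_one (n Z x : ℝ) : confidence n Z x ≤ 1 :=
  max_le zero_le_one (min_le_left _ _)

theorem monotone_confidence {n Z : ℝ} (hn : 0 < n) (hZ : 0 < Z) : Monotone (confidence n Z) :=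
  fun _ _ h => max_le_max le_rfl (min_le_min le_rfl ((strictMono_gTilde hn hZ).monotone h))

theorem continuous_confidence {n : ℝ} (hn : 0 < n) (Z : ℝ) : Continuous (confidence n Z) :=
  continuous_const.max (continuous_const.min (continuous_gTilde hn Z))

theorem confidence_of_nonpos {n Z x : ℝ} (hZ : 0 < Z) (hx : x ≤ 0) : confidence n Z x = 0 :=
  max_eq_left ((min_le_right _ _).trans (gTilde_nonpos hZ hx))

theorem confidence_of_threshold_le {n Z x : ℝ} (hn : 0 < n) (hZ : 0 < Z)
    (hU : gTilde n Z (threshold n Z) = 1) (hx : threshold n Z ≤ x) : confidence n Z x = 1 := by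
  have h := (strictMono_gTilde hn hZ).monotone hx
  rw [hU] at h
  rw [confidence, min_eq_left h, max_eq_right zero_le_one]

theorem mul_confidence_nonneg {n Z : ℝ} (hZ : 0 < Z) (x : ℝ) : 0 ≤ x * confidence n Z x := by
  rcases le_total 0 x with h | h
  · exact mul_nonneg h (confidence_nonneg _ _ _)
  · rw [confidence_of_nonpos hZ h, mul_zero]

theorem slopeBound_clip_le {n Z : ℝ} (hn : 0 < n) (hZ : 0 < Z)
    (hU : gTilde n Z (threshold n Z) = 1) (x : ℝ) :
    slopeBound n Z (max 0 (min (threshold n Z) x)) ≤ x * confidence n Z x / (8 * n) + Z / 7 := by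
  unfold slopeBound
  rw [← confidence_eq_gTilde_clip hn hZ hU x]
  rcases le_total 0 x with h | h
  · have h1 : max 0 (min (threshold n Z) x) ≤ x := max_le h (min_le_right _ _)
    have h2 : max 0 (min (threshold n Z) x) * confidence n Z x ≤ x * confidence n Z x :=
      mul_le_mul_of_nonneg_right h1 (confidence_nonneg _ _ _)
    have h3 : max 0 (min (threshold n Z) x) / (8 * n) * confidence n Z x
      = max 0 (min (threshold n Z) x) * confidence n Z x / (8 * n) := by ring
    rw [h3]
    gcongr
  · simp [confidence_of_nonpos hZ h]

/-- Between points at distance at most `2 m` the confidence function changes with a slope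
controlled by its value at either of the points. -/
theorem abs_confidence_sub_le {n Z m x y : ℝ} (hn : 0 < n) (hZ : 0 < Z)
    (hU : gTilde n Z (threshold n Z) = 1) (hU0 : 0 ≤ threshold n Z)
    (hm : m * threshold n Z ≤ 3 / 4 * n) (hxy : |y - x| ≤ 2 * m) :
    |confidence n Z y - confidence n Z x| ≤
      |y - x| * (3 / 2 * (x * confidence n Z x / (8 * n) + Z / 7)) := by
  set U := threshold n Z
  let c : ℝ → ℝ := fun x => max 0 (min U x)
  have hc0 : ∀ x, 0 ≤ c x := fun x => le_max_left _ _
  have hcU : ∀ x, c x ≤ U := fun x => max_le hU0 (min_le_left _ _)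
  have hcm : Monotone c := fun a b h => max_le_max le_rfl (min_le_min le_rfl h)
  have hcl : ∀ a b, a ≤ b → c b - c a ≤ b - a := by
    intro a b h
    have : c b ≤ c a + (b - a) := by
      refine max_le (by linarith [hc0 a]) ?_
      rcases le_total U a with h' | h'
      · have : U ≤ c a := le_max_of_le_right (le_min le_rfl h')
        exact (min_le_left _ _).trans (by linarith)
      · have : a ≤ c a := le_max_of_le_right (le_min h' le_rfl)
        exact (min_le_right _ _).trans (by linarith)
    linarith
  -- Moving the slope from the right end to x costs e^{(2m)(2U)/(8n)}, and the hypothesis on mU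
  -- makes the exponent at most 3/8.
  have hexp : Real.exp (3 / 8) ≤ 3 / 2 := by
    have h2 : Real.exp (3 / 8) ^ 8 ≤ (3 / 2) ^ 8 := by
      rw [← Real.exp_nat_mul, show ((8 : ℕ) : ℝ) * (3 / 8) = ((3 : ℕ) : ℝ) * 1 by norm_num,
        Real.exp_nat_mul]
      have := Real.exp_one_lt_d9
      calc Real.exp 1 ^ 3 ≤ 2.7182818286 ^ 3 := by gcongr
        _ ≤ _ := by norm_num
    exact le_of_pow_le_pow_left₀ (by norm_num) (by norm_num) h2
  have key : ∀ a b, a ≤ b → b - a ≤ 2 * m → (x = a ∨ x = b) →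
      gTilde n Z (c b) - gTilde n Z (c a) ≤
        (b - a) * (3 / 2 * (x * confidence n Z x / (8 * n) + Z / 7)) := by
    intro a b hab hb hx
    have h1 := gTilde_sub_le hn hZ (hc0 a) (hcm hab)
    have h2 : slopeBound n Z (c b) ≤ 3 / 2 * slopeBound n Z (c x) := by
      have hp := slopeBound_pos hn hZ (hc0 x)
      rcases hx with rfl | rfl
      · have h3 := slopeBound_growth hn hZ (hc0 x) (hcm hab)
        have h4 : (c b ^ 2 - c x ^ 2) / (8 * n) ≤ 3 / 8 := by
          rw [div_le_iff₀ (by positivity)]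
          have h5 := hcl _ _ hab
          have h6 : c b ^ 2 - c x ^ 2 = (c b - c x) * (c b + c x) := by ring
          have h7 : (c b - c x) * (c b + c x) ≤ (2 * m) * (2 * U) := by
            have := hc0 x; have := hc0 b; have := hcU x; have := hcU b
            gcongr
            · linarith
            · linarith
            · linarith
          nlinarith
        have h5 := (Real.exp_le_exp.2 h4).trans hexp
        nlinarith
      · linarith
    have h3 := slopeBound_clip_le hn hZ hU x
    have h4 := slopeBound_pos hn hZ (hc0 b)
    calc _ ≤ slopeBound n Z (c b) * (c b - c a) := h1
      _ ≤ slopeBound n Z (c b) * (b - a) := by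
        have := hcl _ _ hab
        gcongr
      _ ≤ (3 / 2 * (x * confidence n Z x / (8 * n) + Z / 7)) * (b - a) := by
        refine mul_le_mul_of_nonneg_right (h2.trans ?_) (by linarith)
        linarith
      _ = _ := by ring
  rcases le_total x y with h | h
  · rw [abs_of_nonneg (sub_nonneg.2 (monotone_confidence hn hZ h)), abs_of_nonneg (by linarith)]
    rw [abs_of_nonneg (by linarith)] at hxy
    have := key x y h hxy (Or.inl rfl)
    rwa [← confidence_eq_gTilde_clip hn hZ hU, ← confidence_eq_gTilde_clip hn hZ hU] at this
  · rw [abs_sub_comm, abs_of_nonneg (sub_nonneg.2 (monotone_confidence hn hZ h)), abs_sub_comm y,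
      abs_of_nonneg (by linarith)]
    rw [abs_sub_comm, abs_of_nonneg (by linarith)] at hxy
    have := key y x h hxy (Or.inr rfl)
    rwa [← confidence_eq_gTilde_clip hn hZ hU, ← confidence_eq_gTilde_clip hn hZ hU] at this

end SmoothedOCO

/-! ### The potential and a single round of Discounted-Normal-Predictor. -/

namespace SmoothedOCO

/-- The potential function of Discounted-Normal-Predictor, the primitive of its confidence
function. -/
noncomputable def potential (n Z x : ℝ) : ℝ := ∫ y in (0 : ℝ)..x, confidence n Z y

theorem potential_sub {n : ℝ} (hn : 0 < n) (Z x y : ℝ) :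
    potential n Z y - potential n Z x = ∫ z in x..y, confidence n Z z :=
  intervalIntegral.integral_interval_sub_left ((continuous_confidence hn Z).intervalIntegrable _ _)
    ((continuous_confidence hn Z).intervalIntegrable _ _)

theorem potential_of_nonpos {n Z x : ℝ} (hZ : 0 < Z) (hx : x ≤ 0) : potential n Z x = 0 := by
  refine (intervalIntegral.integral_congr fun y hy => ?_).trans
    (intervalIntegral.integral_zero (μ := MeasureTheory.volume))
  rw [Set.uIcc_of_ge hx] at hy
  exact confidence_of_nonpos hZ hy.2

theorem potential_nonneg {n Z : ℝ} (hZ : 0 < Z) (x : ℝ) : 0 ≤ potential n Z x := by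
  rcases le_total 0 x with h | h
  · exact intervalIntegral.integral_nonneg h fun y _ => confidence_nonneg n Z y
  · rw [potential_of_nonpos hZ h]

theorem potential_le {n Z : ℝ} (hn : 0 < n) (hZ : 0 < Z) (x : ℝ) :
    potential n Z x ≤ max 0 x := by
  rcases le_total 0 x with h | h
  · refine le_max_of_le_right ?_
    have := intervalIntegral.integral_mono_on (μ := MeasureTheory.volume) h
      ((continuous_confidence hn Z).intervalIntegrable _ _)
      (intervalIntegrable_const (c := (1 : ℝ))) fun y _ => confidence_le_one n Z y
    simpa [potential] using this
  · rw [potential_of_nonpos hZ h]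
    exact le_max_left _ _

/-- By monotonicity the integral of g from x to y is at most g(y)(y-x), for either order of x and y;
the excess over the linear term is the product of the two increments. -/
theorem potential_sub_le {n Z : ℝ} (hn : 0 < n) (hZ : 0 < Z) (x y : ℝ) :
    potential n Z y - potential n Z x ≤
      confidence n Z x * (y - x) + |y - x| * |confidence n Z y - confidence n Z x| := by
  have hm := monotone_confidence hn hZ
  have hi : ∀ a b, IntervalIntegrable (confidence n Z) MeasureTheory.volume a b :=
    fun a b => (continuous_confidence hn Z).intervalIntegrable a b
  rw [potential_sub hn]
  rcases le_total x y with h | h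
  · have := intervalIntegral.integral_mono_on (μ := MeasureTheory.volume) h (hi x y)
      (intervalIntegrable_const (c := confidence n Z y)) fun z hz => hm hz.2
    rw [intervalIntegral.integral_const, smul_eq_mul] at this
    rw [abs_of_nonneg (sub_nonneg.2 h), abs_of_nonneg (sub_nonneg.2 (hm h))]
    linarith
  · have := intervalIntegral.integral_mono_on (μ := MeasureTheory.volume) h
      (intervalIntegrable_const (c := confidence n Z y)) (hi y x) fun z hz => hm hz.1
    rw [intervalIntegral.integral_const, smul_eq_mul] at this
    rw [intervalIntegral.integral_symm, abs_of_nonpos (sub_nonpos.2 h),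
      abs_of_nonpos (sub_nonpos.2 (hm h))]
    linarith

theorem sum_le_of_forall_le {F c : ℕ → ℝ} {C : ℝ} {r s : ℕ} (hrs : r ≤ s)
    (hF : ∀ t ∈ Finset.Icc r s, F t ≤ c (t + 1) - c t + C) :
    ∑ t ∈ Finset.Icc r s, F t ≤ c (s + 1) - c r + ((s : ℝ) - r + 1) * C := by
  refine (Finset.sum_le_sum hF).trans ?_
  rw [Finset.sum_add_distrib, ← Finset.Ico_succ_right_eq_Icc, Finset.sum_Ico_sub _ (by simp; omega)]
  simp [Nat.cast_sub (show r ≤ s + 1 by omega)]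
  linarith

/-- The standing assumptions on the parameters of Discounted-Normal-Predictor with conservative
updating, for bits of absolute value at most `m`. -/
structure DnpParams (n Z m : ℝ) : Prop where
  Z_pos : 0 < Z
  one_le_log : 1 ≤ Real.log (1 / Z)
  m_pos : 0 < m
  m_le_one : m ≤ 1
  le_n : 32 * Real.log (1 / Z) ≤ m ^ 2 * n

namespace DnpParams

variable {n Z m : ℝ} (h : DnpParams n Z m)
include h

theorem le_n' : 32 * Real.log (1 / Z) ≤ n := by
  have h1 := h.m_pos
  have h2 := h.m_le_one
  have h3 := h.le_n
  have h4 := h.one_le_log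
  have h5 : 0 < n := by
    by_contra hn
    have : m ^ 2 * n ≤ 0 := mul_nonpos_of_nonneg_of_nonpos (by positivity) (by linarith)
    linarith
  have : m ^ 2 ≤ 1 := pow_le_one₀ h1.le h2
  nlinarith

theorem n_ge : 32 ≤ n := by
  have := h.le_n'
  have := h.one_le_log
  linarith

theorem n_pos : 0 < n := by linarith [h.n_ge]

theorem gTilde_threshold : gTilde n Z (threshold n Z) = 1 :=
  SmoothedOCO.gTilde_threshold h.Z_pos h.one_le_log h.n_ge

theorem threshold_pos : 0 < threshold n Z :=
  SmoothedOCO.threshold_pos h.Z_pos h.one_le_log h.n_ge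

theorem threshold_le : threshold n Z ≤ 4 * √(n * Real.log (1 / Z)) :=
  SmoothedOCO.threshold_le h.Z_pos h.one_le_log h.n_ge

theorem threshold_le_mul : threshold n Z ≤ 71 / 100 * (m * n) := by
  refine h.threshold_le.trans ?_
  have := h.m_pos
  have := h.n_pos
  -- From L ≤ m²n/32 the root is at most mn/√32, and 4/√32 < 0.71.
  have h1 : √(n * Real.log (1 / Z)) ≤ 71 / 400 * (m * n) := by
    refine Real.sqrt_le_iff.2 ⟨by positivity, ?_⟩
    have h2 := mul_le_mul_of_nonneg_left h.le_n h.n_pos.le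
    have h3 : 0 ≤ n * (m ^ 2 * n) := by positivity
    nlinarith
  linarith

theorem m_mul_threshold_le : m * threshold n Z ≤ 3 / 4 * n := by
  have h1 := h.threshold_le_mul
  have h2 := h.m_pos
  have h3 := h.m_le_one
  have h4 := h.n_pos
  have h5 := mul_le_mul_of_nonneg_left h1 h2.le
  have h6 : m * m ≤ 1 := by nlinarith
  nlinarith

theorem sqrt_ge : 5 ≤ √(n * Real.log (1 / Z)) :=
  Real.le_sqrt_of_sq_le (by nlinarith [h.n_ge, h.one_le_log])

theorem threshold_add_le : threshold n Z + m + 1 ≤ 5 * √(n * Real.log (1 / Z)) := by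
  linarith [h.threshold_le, h.sqrt_ge, h.m_le_one]

theorem threshold_add_div_le : (threshold n Z + m) / n ≤ m := by
  rw [div_le_iff₀ h.n_pos]
  have := h.threshold_le_mul
  have := h.n_ge
  have := h.m_pos
  nlinarith

/-- The change of the confidence along a discounted update. -/
theorem abs_sub_le {x y : ℝ} (hxy : |y - x| ≤ 2 * m) :
    |confidence n Z y - confidence n Z x| ≤
      3 * m * (x * confidence n Z x / (8 * n) + Z / 7) := by
  refine (abs_confidence_sub_le h.n_pos h.Z_pos h.gTilde_threshold h.threshold_pos.le
    h.m_mul_threshold_le hxy).trans ?_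
  have h1 := mul_confidence_nonneg (n := n) h.Z_pos x
  have h2 := h.Z_pos
  have h3 := h.n_pos
  have h4 : 0 ≤ 3 / 2 * (x * confidence n Z x / (8 * n) + Z / 7) := by positivity
  calc _ ≤ 2 * m * (3 / 2 * (x * confidence n Z x / (8 * n) + Z / 7)) := by gcongr
    _ = _ := by ring

/-- The second-order error and the penalty a·|Δg| together are at most (2m + 1/(3m))·3m = 6m² + 1 ≤
7 times x·g/(8n) + Z/7. This is 7/8 of the gain x·g/n from discounting, plus Z. -/
theorem potential_step {a x y c : ℝ} (ha : a ≤ 1 / (3 * m)) (hxy : |y - x| ≤ 2 * m)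
    (hy : y = x - x / n + c) :
    potential n Z y - potential n Z x + a * |confidence n Z y - confidence n Z x| ≤
      confidence n Z x * c + Z := by
  have h0 := h.n_pos
  have hm := h.m_pos
  have hm1 := h.m_le_one
  have h1 := potential_sub_le h.n_pos h.Z_pos x y
  have h2 := h.abs_sub_le hxy
  set g := confidence n Z x
  set d := |confidence n Z y - g|
  have hd : 0 ≤ d := abs_nonneg _
  have h3 := mul_confidence_nonneg (n := n) h.Z_pos x
  have h3' : 0 ≤ x * g / (8 * n) + Z / 7 := by have := h.Z_pos; positivity
  have h4 : |y - x| * d + a * d ≤ 7 * (x * g / (8 * n) + Z / 7) := by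
    calc |y - x| * d + a * d ≤ (2 * m + 1 / (3 * m)) * d := by
          rw [← add_mul]
          gcongr
      _ ≤ (2 * m + 1 / (3 * m)) * (3 * m * (x * g / (8 * n) + Z / 7)) := by gcongr
      _ = (6 * m ^ 2 + 1) * (x * g / (8 * n) + Z / 7) := by field_simp; ring
      _ ≤ _ := by
        have : m ^ 2 ≤ 1 := pow_le_one₀ hm.le hm1
        gcongr
        linarith
  have h5 : g * (y - x) = g * c - x * g / n := by rw [hy]; ring
  have h6 : x * g / (8 * n) = x * g / n / 8 := by field_simp
  have h7 : 0 ≤ x * g / n := by positivity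
  rw [h6] at h4
  rw [h5] at h1
  linarith

/-- Here c is b or 0. A bit is dropped only when the prediction is saturated and the bit pushes
further out: g = 0 with b ≤ 0, or g = 1 with b ≥ 0. Dropping it spoils neither comparison and
confines the deviation. -/
theorem exists_dnpStep {x b : ℝ} (hb : |b| ≤ m) (hx : -m ≤ x) (hx' : x ≤ threshold n Z + m) :
    ∃ c, |c| ≤ m ∧ dnpStep n Z x b = x - x / n + c ∧
      confidence n Z x * c ≤ confidence n Z x * b ∧
      (1 - confidence n Z x) * b ≤ (1 - confidence n Z x) * c ∧
      -m ≤ dnpStep n Z x b ∧ dnpStep n Z x b ≤ threshold n Z + m := by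
  have hn := h.n_pos
  have hU := h.threshold_pos
  have hm := h.m_pos
  have e : (1 - 1 / n) * x = x - x / n := by ring
  have hn1 : 1 / n ≤ 1 := by rw [div_le_one hn]; linarith [h.n_ge]
  have hb' := abs_le.1 hb
  have hpos : 0 ≤ x → 0 ≤ x - x / n ∧ x - x / n ≤ x := fun hx0 => by
    rw [← e]
    exact ⟨mul_nonneg (by linarith) hx0, by rw [e]; linarith [div_nonneg hx0 hn.le]⟩
  have hneg : x ≤ 0 → x - x / n ≤ 0 ∧ x ≤ x - x / n := fun hx0 => by
    rw [← e]
    exact ⟨mul_nonpos_of_nonneg_of_nonpos (by linarith) hx0,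
      by rw [e]; linarith [div_nonpos_of_nonpos_of_nonneg hx0 hn.le]⟩
  unfold dnpStep
  rw [e]
  split_ifs with hc
  · refine ⟨b, hb, rfl, le_rfl, le_rfl, ?_⟩
    rcases hc with ⟨h1, h2⟩ | ⟨h1, h2⟩ | ⟨h1, h2⟩
    · have := hpos h1
      constructor <;> linarith
    · have := hneg h1.le
      constructor <;> linarith
    · have := hpos (by linarith)
      constructor <;> linarith
  · push Not at hc
    obtain ⟨h1, h2, h3⟩ := hc
    refine ⟨0, by simpa using hm.le, by ring, ?_⟩
    rcases lt_or_ge x 0 with h4 | h4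
    · rw [confidence_of_nonpos h.Z_pos h4.le]
      have := hneg h4.le
      have := h2 h4
      refine ⟨by simp, by linarith, by linarith, by linarith⟩
    · have h5 := h1 h4
      rw [confidence_of_threshold_le hn h.Z_pos h.gTilde_threshold h5.le]
      have := hpos h4
      have := h3 h5
      refine ⟨by linarith, by simp, by linarith, by linarith⟩

theorem dnpDeviation_mem {b : ℕ → ℝ} {T : ℕ} (hb : ∀ t ∈ Finset.Icc 1 T, |b t| ≤ m) :
    ∀ t ≤ T + 1, -m ≤ dnpDeviation n Z b t ∧ dnpDeviation n Z b t ≤ threshold n Z + m := by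
  have hm := h.m_pos
  have hU := h.threshold_pos
  intro t
  induction t with
  | zero => intro _; rw [dnpDeviation]; constructor <;> linarith
  | succ t ih =>
    intro ht
    rw [dnpDeviation]
    split_ifs with h0
    · constructor <;> linarith
    · obtain ⟨h1, h2⟩ := ih (by omega)
      obtain ⟨c, -, -, -, -, h3⟩ :=
        h.exists_dnpStep (hb t (Finset.mem_Icc.2 ⟨by omega, by omega⟩)) h1 h2
      exact h3

/-- One round of Discounted-Normal-Predictor with conservative updating: a bound on the drift of
the confidence, and the two potential inequalities behind the comparison with the constant
predictions `0` and `1`. -/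
theorem dnp_round {b : ℕ → ℝ} {T : ℕ} (hb : ∀ t ∈ Finset.Icc 1 T, |b t| ≤ m) {a : ℝ}
    (ha : a ≤ 1 / (3 * m)) {t : ℕ} (ht : t ∈ Finset.Icc 1 T) :
    |dnpPrediction n Z b (t + 1) - dnpPrediction n Z b t| ≤
        3 * m * (5 / 8 * (√(n * Real.log (1 / Z)) / n) + Z / 7) ∧
      -(dnpPrediction n Z b t * b t) + a * |dnpPrediction n Z b (t + 1) - dnpPrediction n Z b t| ≤
        potential n Z (dnpDeviation n Z b t) - potential n Z (dnpDeviation n Z b (t + 1)) + Z ∧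
      (1 - dnpPrediction n Z b t) * b t +
          a * |dnpPrediction n Z b (t + 1) - dnpPrediction n Z b t| ≤
        (dnpDeviation n Z b (t + 1) - potential n Z (dnpDeviation n Z b (t + 1))) -
          (dnpDeviation n Z b t - potential n Z (dnpDeviation n Z b t)) +
          (5 * (√(n * Real.log (1 / Z)) / n) + Z) := by
  have hm := h.m_pos
  have hn := h.n_pos
  rw [Finset.mem_Icc] at ht
  obtain ⟨h1, h2⟩ := h.dnpDeviation_mem hb t (by omega)
  obtain ⟨c, hc, e, h3, h4, -⟩ := h.exists_dnpStep (hb t (Finset.mem_Icc.2 ht)) h1 h2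
  have e' : dnpDeviation n Z b (t + 1) = dnpStep n Z (dnpDeviation n Z b t) (b t) := by
    rw [dnpDeviation, if_neg (by omega)]
  rw [← e'] at e
  unfold dnpPrediction
  set x := dnpDeviation n Z b t
  set y := dnpDeviation n Z b (t + 1)
  have hV : x ≤ 5 * √(n * Real.log (1 / Z)) := by linarith [h.threshold_add_le]
  have hxn : |x / n| ≤ m := by
    rw [abs_div, abs_of_pos hn]
    refine le_trans ?_ h.threshold_add_div_le
    gcongr
    exact abs_le.2 ⟨by linarith [h.threshold_pos], h2⟩
  have hxy : |y - x| ≤ 2 * m := by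
    have h5 := abs_le.1 hxn
    have h6 := abs_le.1 hc
    rw [e, abs_le]
    constructor <;> linarith
  have hstep := h.potential_step ha hxy e
  refine ⟨(h.abs_sub_le hxy).trans ?_, by linarith, ?_⟩
  · have h5 : x * confidence n Z x ≤ 5 * √(n * Real.log (1 / Z)) := by
      have h6 := confidence_nonneg n Z x
      have h7 := confidence_le_one n Z x
      have h8 : 0 ≤ √(n * Real.log (1 / Z)) := Real.sqrt_nonneg _
      nlinarith
    have h6 : x * confidence n Z x / (8 * n) ≤ 5 * √(n * Real.log (1 / Z)) / (8 * n) := by gcongr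
    have h7 : 5 * √(n * Real.log (1 / Z)) / (8 * n) = 5 / 8 * (√(n * Real.log (1 / Z)) / n) := by
      ring
    rw [h7] at h6
    gcongr
  -- Against the weight 1 the discount is a loss: c equals y - x plus x/n, which is the source of
  -- the additional drift term.
  · have h5 : x / n ≤ 5 * √(n * Real.log (1 / Z)) / n := by gcongr
    have h6 : 5 * √(n * Real.log (1 / Z)) / n = 5 * (√(n * Real.log (1 / Z)) / n) := by ring
    rw [h6] at h5
    linarith

end DnpParams
end SmoothedOCO

/-! ### Interval regret of the predictor against constant weights. -/

namespace SmoothedOCO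

namespace DnpParams

variable {n Z m : ℝ} (h : DnpParams n Z m)
include h

/-- The comparison of Discounted-Normal-Predictor with the constant prediction `0`. -/
theorem sum_neg_mul_le {b : ℕ → ℝ} {T : ℕ} (hb : ∀ t ∈ Finset.Icc 1 T, |b t| ≤ m) {a : ℝ}
    (ha : a ≤ 1 / (3 * m)) {r s : ℕ} (hr : 1 ≤ r) (hrs : r ≤ s) (hs : s ≤ T) :
    ∑ t ∈ Finset.Icc r s, (-(dnpPrediction n Z b t * b t) +
        a * |dnpPrediction n Z b (t + 1) - dnpPrediction n Z b t|) ≤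
      5 * √(n * Real.log (1 / Z)) + ((s : ℝ) - r + 1) * Z := by
  have h1 := sum_le_of_forall_le
    (F := fun t => -(dnpPrediction n Z b t * b t) +
      a * |dnpPrediction n Z b (t + 1) - dnpPrediction n Z b t|)
    (c := fun t => -potential n Z (dnpDeviation n Z b t)) (C := Z) hrs
    fun t ht => by
      have ht' := Finset.mem_Icc.1 ht
      have := (h.dnp_round hb ha (Finset.mem_Icc.2 ⟨by omega, by omega⟩ : t ∈ _)).2.1
      linarith
  refine h1.trans ?_
  have h2 := potential_nonneg (n := n) h.Z_pos (dnpDeviation n Z b (s + 1))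
  have h3 := potential_le h.n_pos h.Z_pos (dnpDeviation n Z b r)
  have h4 : max 0 (dnpDeviation n Z b r) ≤ threshold n Z + m :=
    max_le (by linarith [h.threshold_pos, h.m_pos]) (h.dnpDeviation_mem hb r (by omega)).2
  linarith [h.threshold_add_le]

/-- The comparison of Discounted-Normal-Predictor with the constant prediction `1`. -/
theorem sum_one_sub_mul_le {b : ℕ → ℝ} {T : ℕ} (hb : ∀ t ∈ Finset.Icc 1 T, |b t| ≤ m) {a : ℝ}
    (ha : a ≤ 1 / (3 * m)) {r s : ℕ} (hr : 1 ≤ r) (hrs : r ≤ s) (hs : s ≤ T) :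
    ∑ t ∈ Finset.Icc r s, ((1 - dnpPrediction n Z b t) * b t +
        a * |dnpPrediction n Z b (t + 1) - dnpPrediction n Z b t|) ≤
      5 * √(n * Real.log (1 / Z)) +
        ((s : ℝ) - r + 1) * (5 * (√(n * Real.log (1 / Z)) / n) + Z) := by
  have h1 := sum_le_of_forall_le
    (c := fun t => dnpDeviation n Z b t - potential n Z (dnpDeviation n Z b t)) hrs
    fun t ht => by
      have ht' := Finset.mem_Icc.1 ht
      exact (h.dnp_round hb ha (Finset.mem_Icc.2 ⟨by omega, by omega⟩ : t ∈ _)).2.2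
  refine h1.trans ?_
  have h2 := potential_nonneg (n := n) h.Z_pos (dnpDeviation n Z b (s + 1))
  have h3 := potential_le h.n_pos h.Z_pos (dnpDeviation n Z b r)
  have h4 := h.dnpDeviation_mem hb r (by omega)
  have h5 := h.dnpDeviation_mem hb (s + 1) (by omega)
  -- The initial term Φ(x_r) - x_r is at most m, since the deviation never falls below -m.
  have h6 : max 0 (dnpDeviation n Z b r) ≤ dnpDeviation n Z b r + m :=
    max_le (by linarith) (by linarith [h.m_pos])
  linarith [h.threshold_add_le, h.m_le_one]

end DnpParams

/-! ### Projected gradient descent against moving comparators. -/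

variable {E : Type*} [NormedAddCommGroup E] [InnerProductSpace ℝ E]

theorem scale_pos {T : ℕ} (hT : 0 < T) (i : ℕ) : 0 < scale T i := by
  unfold scale
  positivity

theorem dist_proj_le [CompleteSpace E] {W : Set E} (hcl : IsClosed W) (hW : Convex ℝ W) {u : E}
    (hu : u ∈ W) (x : E) : ‖proj W x - u‖ ≤ ‖x - u‖ := by
  obtain ⟨h1, h2⟩ := proj_spec ⟨u, hu⟩ hcl hW x
  have h3 := (norm_eq_iInf_iff_real_inner_le_zero hW h1).1 h2 u hu
  refine le_of_sq_le_sq ?_ (norm_nonneg _)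
  have h4 : x - u = (x - proj W x) - (u - proj W x) := by abel
  rw [h4, norm_sub_sq_real (x - proj W x), norm_sub_rev (proj W x) u]
  nlinarith [sq_nonneg ‖x - proj W x‖]

/-- The first-order condition for a convex function on a convex set. -/
theorem sub_le_inner_of_hasGradientWithinAt [CompleteSpace E] {W : Set E} {f : E → ℝ} {g w u : E}
    (hf : ConvexOn ℝ W f) (hg : HasGradientWithinAt f g W w) (hw : w ∈ W) (hu : u ∈ W) :
    f w - f u ≤ inner ℝ g (w - u) := by
  have hc := hf.comp_affineMap (AffineMap.lineMap (k := ℝ) w u)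
  have hd : HasDerivWithinAt (AffineMap.lineMap (k := ℝ) w u) (u - w)
      (AffineMap.lineMap (k := ℝ) w u ⁻¹' W) 0 := AffineMap.hasDerivWithinAt_lineMap
  have hd' := hg.hasFDerivWithinAt.comp_hasDerivWithinAt_of_eq (0 : ℝ) hd (Set.mapsTo_preimage _ _)
    (by simp)
  have h := hc.le_slope_of_hasDerivWithinAt (x := 0) (y := 1) (by simpa using hw)
    (by simpa using hu) one_pos hd'
  simp only [slope_def_field, Function.comp_apply, AffineMap.lineMap_apply_one,
    AffineMap.lineMap_apply_zero, sub_zero, div_one, InnerProductSpace.toDual_apply_apply] at h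
  rw [← neg_sub w u, inner_neg_right] at h
  linarith

/-- Convex losses with gradients bounded by `G` on a closed convex domain of diameter at
most `D`. -/
structure IsBoundedOCO [CompleteSpace E] (W : Set E) (f : ℕ → E → ℝ) (grad : ℕ → E → E)
    (G D : ℝ) (T : ℕ) : Prop where
  G_pos : 0 < G
  D_pos : 0 < D
  closed : IsClosed W
  convex : Convex ℝ W
  diam : ∀ w ∈ W, ∀ w' ∈ W, ‖w - w'‖ ≤ D
  convexOn : ∀ t ∈ Finset.Icc 1 T, ConvexOn ℝ W (f t)
  hasGradient : ∀ t ∈ Finset.Icc 1 T, ∀ w ∈ W, HasGradientWithinAt (f t) (grad t w) W w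
  norm_grad : ∀ t ∈ Finset.Icc 1 T, ∀ w ∈ W, ‖grad t w‖ ≤ G

/-- Factor the difference of squares: the sum of the two distances is at most 2D. This is the price
of moving the comparator from u to v. -/
theorem sq_le_path {E : Type*} [SeminormedAddCommGroup E] {D : ℝ} {w u v : E} (hu : ‖w - u‖ ≤ D) (hv : ‖w - v‖ ≤ D) :
    ‖w - v‖ ^ 2 ≤ ‖w - u‖ ^ 2 + 2 * D * ‖u - v‖ := by
  have h : ‖w - v‖ ≤ ‖w - u‖ + ‖u - v‖ := norm_sub_le_norm_sub_add_norm_sub _ _ _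
  nlinarith [norm_nonneg (w - u), norm_nonneg (w - v), norm_nonneg (u - v)]

theorem ogd_mem [CompleteSpace E] {W : Set E} (hcl : IsClosed W) (hW : Convex ℝ W)
    (grad : ℕ → E → E) (η : ℝ) {x₁ : E} (hx : x₁ ∈ W) (t : ℕ) : ogd W grad η x₁ t ∈ W := by
  cases t with
  | zero => exact hx
  | succ t =>
    rw [ogd]
    split_ifs
    · exact hx
    · exact (proj_spec ⟨x₁, hx⟩ hcl hW _).1

namespace IsBoundedOCO

variable [CompleteSpace E] {W : Set E} {f : ℕ → E → ℝ} {grad : ℕ → E → E} {G D : ℝ} {T : ℕ}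
  (h : IsBoundedOCO W f grad G D T)
include h

theorem loss_sub_le {t : ℕ} (ht : t ∈ Finset.Icc 1 T) {w u : E} (hw : w ∈ W) (hu : u ∈ W) :
    f t w - f t u ≤ G * D := by
  refine (sub_le_inner_of_hasGradientWithinAt (h.convexOn t ht) (h.hasGradient t ht w hw)
    hw hu).trans ?_
  refine (real_inner_le_norm _ _).trans ?_
  have := h.G_pos
  have := h.norm_grad t ht w hw
  have := h.diam w hw u hu
  gcongr

theorem ogd_sub_le {η : ℝ} (hη : 0 < η) {x₁ : E} (hx : x₁ ∈ W) {t : ℕ}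
    (ht : t ∈ Finset.Icc 1 T) :
    ‖ogd W grad η x₁ t - ogd W grad η x₁ (t + 1)‖ ≤ η * G := by
  have hw := ogd_mem h.closed h.convex grad η hx t
  have h0 : t ≠ 0 := by have := Finset.mem_Icc.1 ht; omega
  rw [norm_sub_rev, ogd, if_neg h0]
  refine (dist_proj_le h.closed h.convex hw _).trans ?_
  rw [sub_sub_cancel_left, norm_neg, norm_smul, Real.norm_of_nonneg hη.le]
  have := h.norm_grad t ht _ hw
  gcongr

theorem ogd_loss_le {η : ℝ} (hη : 0 < η) {x₁ : E} (hx : x₁ ∈ W) {t : ℕ}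
    (ht : t ∈ Finset.Icc 1 T) {u : E} (hu : u ∈ W) :
    f t (ogd W grad η x₁ t) - f t u ≤
      (‖ogd W grad η x₁ t - u‖ ^ 2 - ‖ogd W grad η x₁ (t + 1) - u‖ ^ 2) / (2 * η)
        + η * G ^ 2 / 2 := by
  have hw := ogd_mem h.closed h.convex grad η hx t
  have h0 : t ≠ 0 := by have := Finset.mem_Icc.1 ht; omega
  set w := ogd W grad η x₁ t with hwdef
  have h1 := sub_le_inner_of_hasGradientWithinAt (h.convexOn t ht) (h.hasGradient t ht w hw) hw hu
  have h2 : ‖ogd W grad η x₁ (t + 1) - u‖ ≤ ‖(w - u) - η • grad t w‖ := by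
    rw [ogd, if_neg h0, sub_right_comm]
    exact dist_proj_le h.closed h.convex hu _
  have h3 := pow_le_pow_left₀ (norm_nonneg _) h2 2
  rw [norm_sub_sq_real (w - u), inner_smul_right, norm_smul, Real.norm_of_nonneg hη.le,
    real_inner_comm] at h3
  have h4 : ‖grad t w‖ ^ 2 ≤ G ^ 2 := pow_le_pow_left₀ (norm_nonneg _) (h.norm_grad t ht w hw) 2
  have h5 : (η * ‖grad t w‖) ^ 2 ≤ η ^ 2 * G ^ 2 := by rw [mul_pow]; gcongr
  refine h1.trans ?_
  have h6 : (‖w - u‖ ^ 2 - ‖ogd W grad η x₁ (t + 1) - u‖ ^ 2) / (2 * η) + η * G ^ 2 / 2 =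
      (‖w - u‖ ^ 2 - ‖ogd W grad η x₁ (t + 1) - u‖ ^ 2 + η ^ 2 * G ^ 2) / (2 * η) := by
    field_simp
  rw [h6, le_div_iff₀ (by positivity)]
  linarith

/-- The quantity ‖w_t - u_t‖²/(2η) telescopes up to D/η per unit of comparator movement. A step has
length at most ηG, so the switching cost ληG² merges with ηG²/2. -/
theorem ogd_regret_le {η lam : ℝ} (hη : 0 < η) (hlam : 0 ≤ lam) {x₁ : E} (hx : x₁ ∈ W) {r s : ℕ}
    (hr : 1 ≤ r) (hrs : r ≤ s) (hs : s ≤ T) {u : ℕ → E} (hu : ∀ t ∈ Finset.Icc r s, u t ∈ W) :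
    dynamicRegret f lam G (ogd W grad η x₁) u r s ≤
      D ^ 2 / (2 * η) + D / η * pathLength u r s +
        ((s : ℝ) - r + 1) * ((1 + 2 * lam) * η * G ^ 2 / 2) := by
  have hG := h.G_pos
  have hD := h.D_pos
  set w := ogd W grad η x₁ with hwdef
  have hw : ∀ t, w t ∈ W := ogd_mem h.closed h.convex grad η hx
  -- The comparator is frozen after round s: u_{s+1} need not lie in W, and freezing only shortens
  -- the path.
  let v : ℕ → E := fun t => u (min t s)
  have hv : ∀ t, r ≤ t → v t ∈ W := fun t ht =>
    hu _ (Finset.mem_Icc.2 ⟨le_min ht hrs, min_le_right _ _⟩)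
  have hP : pathLength v r s ≤ pathLength u r s := by
    refine Finset.sum_le_sum fun t ht => ?_
    have ht' := Finset.mem_Icc.1 ht
    rcases ht'.2.eq_or_lt with rfl | hts
    · simp [v]
    · simp [v, min_eq_left hts.le, min_eq_left (Nat.succ_le_of_lt hts)]
  have hround : ∀ t ∈ Finset.Icc r s,
      (f t (w t) + lam * G * ‖w t - w (t + 1)‖ - f t (u t)) - D / η * ‖v t - v (t + 1)‖ ≤
        (-(‖w (t + 1) - v (t + 1)‖ ^ 2 / (2 * η))) - (-(‖w t - v t‖ ^ 2 / (2 * η))) +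
          (1 + 2 * lam) * η * G ^ 2 / 2 := by
    intro t ht
    have ht' := Finset.mem_Icc.1 ht
    have htT : t ∈ Finset.Icc 1 T := Finset.mem_Icc.2 ⟨by omega, by omega⟩
    have huv : v t = u t := by simp [v, ht'.2]
    have h1 := h.ogd_loss_le hη hx htT (hv t ht'.1)
    have h2 := h.ogd_sub_le hη hx htT
    have h3 := sq_le_path (h.diam _ (hw (t + 1)) _ (hv t ht'.1))
      (h.diam _ (hw (t + 1)) _ (hv (t + 1) (by omega)))
    rw [← hwdef] at h1 h2
    rw [← huv]
    have h4 : lam * G * ‖w t - w (t + 1)‖ ≤ lam * G * (η * G) := by gcongr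
    have h5 : ‖w (t + 1) - v (t + 1)‖ ^ 2 / (2 * η) ≤
        (‖w (t + 1) - v t‖ ^ 2 + 2 * D * ‖v t - v (t + 1)‖) / (2 * η) := by gcongr
    have h6 : (‖w (t + 1) - v t‖ ^ 2 + 2 * D * ‖v t - v (t + 1)‖) / (2 * η) =
        ‖w (t + 1) - v t‖ ^ 2 / (2 * η) + D / η * ‖v t - v (t + 1)‖ := by field_simp
    rw [sub_div] at h1
    nlinarith
  have hsum := sum_le_of_forall_le
    (c := fun t => -(‖w t - v t‖ ^ 2 / (2 * η))) hrs hround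
  rw [Finset.sum_sub_distrib, ← Finset.mul_sum] at hsum
  have h7 : ‖w r - v r‖ ^ 2 / (2 * η) ≤ D ^ 2 / (2 * η) := by
    have := h.diam _ (hw r) _ (hv r le_rfl)
    gcongr
  have h8 : 0 ≤ ‖w (s + 1) - v (s + 1)‖ ^ 2 / (2 * η) := by positivity
  have h9 : D / η * pathLength v r s ≤ D / η * pathLength u r s := by gcongr
  unfold dynamicRegret
  unfold pathLength at h9 ⊢
  linarith

theorem expert_regret_le {lam : ℝ} (hlam : 0 ≤ lam) {x₁ : ℕ → E} {i : ℕ} (hx : x₁ i ∈ W)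
    {r s : ℕ} (hr : 1 ≤ r) (hrs : r ≤ s) (hs : s ≤ T) {u : ℕ → E}
    (hu : ∀ t ∈ Finset.Icc r s, u t ∈ W) :
    dynamicRegret f lam G (expert W grad lam G D T x₁ i) u r s ≤
      G * D / 2 * √(1 + 2 * lam) * (√(scale T i) * (1 + 2 * pathLength u r s / D) +
        ((s : ℝ) - r + 1) / √(scale T i)) := by
  have hG := h.G_pos
  have hD := h.D_pos
  have hn : 0 < √(scale T i) := Real.sqrt_pos.2 (scale_pos (by omega) i)
  have hq : 0 < √(1 + 2 * lam) := Real.sqrt_pos.2 (by linarith)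
  have hη : stepSize lam G D T i = D / (G * (√(1 + 2 * lam) * √(scale T i))) := by
    rw [stepSize, Real.sqrt_div zero_le_one, Real.sqrt_one, Real.sqrt_mul (by linarith)]
    field_simp
  have hη0 : 0 < stepSize lam G D T i := by rw [hη]; positivity
  refine (h.ogd_regret_le hη0 hlam hx hr hrs hs hu).trans (le_of_eq ?_)
  rw [hη]
  have e : 1 + 2 * lam = √(1 + 2 * lam) ^ 2 := (Real.sq_sqrt (by linarith)).symm
  generalize √(1 + 2 * lam) = q at *
  rw [e]
  field_simp

theorem expert_sub_le {lam : ℝ} (hlam : 0 ≤ lam) {x₁ : ℕ → E} {i : ℕ} (hx : x₁ i ∈ W)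
    {t : ℕ} (ht : t ∈ Finset.Icc 1 T) :
    lam * ‖expert W grad lam G D T x₁ i t - expert W grad lam G D T x₁ i (t + 1)‖ ≤
      lam / √((1 + 2 * lam) * scale T i) * D := by
  have hG := h.G_pos
  have hD := h.D_pos
  have hn : 0 < scale T i := scale_pos (by have := Finset.mem_Icc.1 ht; omega) i
  have hη : stepSize lam G D T i = D / G * (1 / √((1 + 2 * lam) * scale T i)) := by
    rw [stepSize, Real.sqrt_div zero_le_one, Real.sqrt_one]
  have hη0 : 0 < stepSize lam G D T i := by rw [hη]; positivity
  refine (mul_le_mul_of_nonneg_left (h.ogd_sub_le hη0 hx ht) hlam).trans (le_of_eq ?_)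
  rw [hη]
  field_simp

end IsBoundedOCO
end SmoothedOCO

/-! ### Combining two learners. -/

namespace SmoothedOCO

variable {E : Type*} [NormedAddCommGroup E] [InnerProductSpace ℝ E]

theorem le_sq_max_sqrt_one (lam : ℝ) : lam ≤ max (√lam) 1 ^ 2 := by
  rcases le_total lam 0 with h | h
  · exact h.trans (sq_nonneg _)
  · calc lam = √lam ^ 2 := (Real.sq_sqrt h).symm
      _ ≤ _ := by gcongr; exact le_max_left _ _

theorem combinerWeight_nonneg {E : Type*} [NormedAddCommGroup E] (f : ℕ → E → ℝ)
    (lam G D M n Z : ℝ) (w₁ w₂ : ℕ → E) (t : ℕ) :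
    0 ≤ combinerWeight f lam G D M n Z w₁ w₂ t := confidence_nonneg _ _ _

theorem combinerWeight_le_one {E : Type*} [NormedAddCommGroup E] (f : ℕ → E → ℝ)
    (lam G D M n Z : ℝ) (w₁ w₂ : ℕ → E) (t : ℕ) :
    combinerWeight f lam G D M n Z w₁ w₂ t ≤ 1 := confidence_le_one _ _ _

theorem combiner_mem {W : Set E} (hW : Convex ℝ W) (f : ℕ → E → ℝ) (lam G D M n Z : ℝ)
    {w₁ w₂ : ℕ → E} {t : ℕ} (h₁ : w₁ t ∈ W) (h₂ : w₂ t ∈ W) :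
    combiner f lam G D M n Z w₁ w₂ t ∈ W :=
  hW h₁ h₂ (sub_nonneg.2 (combinerWeight_le_one ..)) (combinerWeight_nonneg ..) (by ring)

theorem norm_convexComb_sub_le {D p q : ℝ} (hp : 0 ≤ p) (hp' : p ≤ 1) {x y x' y' : E}
    (hD : ‖y' - x'‖ ≤ D) :
    ‖((1 - p) • x + p • y) - ((1 - q) • x' + q • y')‖ ≤
      (1 - p) * ‖x - x'‖ + p * ‖y - y'‖ + |q - p| * D := by
  -- The change of weight multiplies only a difference of two points of the domain, hence the factor
  -- D.
  have e : ((1 - p) • x + p • y) - ((1 - q) • x' + q • y') =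
      ((1 - p) • (x - x') + p • (y - y')) - (q - p) • (y' - x') := by module
  rw [e]
  refine (norm_sub_le _ _).trans (add_le_add ((norm_add_le _ _).trans_eq ?_) ?_)
  · rw [norm_smul, norm_smul, Real.norm_of_nonneg hp, Real.norm_of_nonneg (sub_nonneg.2 hp')]
  · rw [norm_smul, Real.norm_eq_abs]
    gcongr

namespace IsBoundedOCO

variable [CompleteSpace E] {W : Set E} {f : ℕ → E → ℝ} {grad : ℕ → E → E} {G D : ℝ} {T : ℕ}
  (h : IsBoundedOCO W f grad G D T) {lam n Z : ℝ} (hlam : 0 ≤ lam) {w₁ w₂ : ℕ → E}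
  (h₁ : ∀ t, w₁ t ∈ W) (h₂ : ∀ t, w₂ t ∈ W)

include h hlam h₁ h₂ in
-- The choice M = 2 is used here: losses differ by at most GD and switching costs by at most 2GD, in
-- total (1+M)GD.
theorem abs_lossGap_le (hs₁ : ∀ t ∈ Finset.Icc 1 T, lam * ‖w₁ t - w₁ (t + 1)‖ ≤ 2 * D)
    (hs₂ : ∀ t ∈ Finset.Icc 1 T, lam * ‖w₂ t - w₂ (t + 1)‖ ≤ 2 * D) :
    ∀ t ∈ Finset.Icc 1 T, |lossGap f lam G D 2 w₁ w₂ t / max (√lam) 1| ≤ 1 / max (√lam) 1 := by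
  intro t ht
  have hG := h.G_pos
  have hD := h.D_pos
  have hμ : (0 : ℝ) < max (√lam) 1 := lt_max_of_lt_right one_pos
  rw [abs_div, abs_of_pos hμ]
  gcongr
  rw [lossGap, abs_div, abs_of_pos (by positivity : (0 : ℝ) < (1 + 2) * G * D),
    div_le_one (by positivity)]
  have a1 := h.loss_sub_le ht (h₁ t) (h₂ t)
  have a2 := h.loss_sub_le ht (h₂ t) (h₁ t)
  have a3 := mul_le_mul_of_nonneg_left (hs₁ t ht) hG.le
  have a4 := mul_le_mul_of_nonneg_left (hs₂ t ht) hG.le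
  have a5 : 0 ≤ G * (lam * ‖w₁ t - w₁ (t + 1)‖) := by positivity
  have a6 : 0 ≤ G * (lam * ‖w₂ t - w₂ (t + 1)‖) := by positivity
  unfold totalLoss
  rw [abs_le]
  constructor <;> linarith

include h hlam h₁ h₂ in
theorem totalLoss_combiner_le {M : ℝ} {t : ℕ} (ht : t ∈ Finset.Icc 1 T) :
    totalLoss f lam G (combiner f lam G D M n Z w₁ w₂) t ≤
      (1 - combinerWeight f lam G D M n Z w₁ w₂ t) * totalLoss f lam G w₁ t +
      combinerWeight f lam G D M n Z w₁ w₂ t * totalLoss f lam G w₂ t +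
      lam * G * D * |combinerWeight f lam G D M n Z w₁ w₂ (t + 1) -
        combinerWeight f lam G D M n Z w₁ w₂ t| := by
  have hG := h.G_pos
  have hp := combinerWeight_nonneg f lam G D M n Z w₁ w₂ t
  have hp' := combinerWeight_le_one f lam G D M n Z w₁ w₂ t
  have a1 := (h.convexOn t ht).2 (h₁ t) (h₂ t) (sub_nonneg.2 hp') hp (by ring)
  have a2 := norm_convexComb_sub_le (q := combinerWeight f lam G D M n Z w₁ w₂ (t + 1))
    (x := w₁ t) (y := w₂ t) hp hp' (h.diam _ (h₂ (t + 1)) _ (h₁ (t + 1)))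
  have a3 := mul_le_mul_of_nonneg_left a2 (mul_nonneg hlam hG.le)
  simp only [smul_eq_mul] at a1
  unfold totalLoss
  rw [combiner, combiner]
  linarith

include h hlam h₁ h₂ in
theorem combiner_sub_le (hn : DnpParams n Z (1 / max (√lam) 1))
    (hs₁ : ∀ t ∈ Finset.Icc 1 T, lam * ‖w₁ t - w₁ (t + 1)‖ ≤ 2 * D)
    (hs₂ : ∀ t ∈ Finset.Icc 1 T, lam * ‖w₂ t - w₂ (t + 1)‖ ≤ 2 * D) {C : ℝ} {t : ℕ}
    (ht : t ∈ Finset.Icc 1 T) (hc₁ : lam * ‖w₁ t - w₁ (t + 1)‖ ≤ C * D)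
    (hc₂ : lam * ‖w₂ t - w₂ (t + 1)‖ ≤ C * D) :
    lam * ‖combiner f lam G D 2 n Z w₁ w₂ t - combiner f lam G D 2 n Z w₁ w₂ (t + 1)‖ ≤
      (C + 3 * max (√lam) 1 * (5 / 8 * (√(n * Real.log (1 / Z)) / n) + Z / 7)) * D := by
  have hD := h.D_pos
  have hμ : (0 : ℝ) < max (√lam) 1 := lt_max_of_lt_right one_pos
  have hμ2 := le_sq_max_sqrt_one lam
  have hp := combinerWeight_nonneg f lam G D 2 n Z w₁ w₂ t
  have hp' := combinerWeight_le_one f lam G D 2 n Z w₁ w₂ t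
  have a0 := (hn.dnp_round (h.abs_lossGap_le hlam h₁ h₂ hs₁ hs₂) le_rfl ht).1
  have a2 := norm_convexComb_sub_le (q := combinerWeight f lam G D 2 n Z w₁ w₂ (t + 1))
    (x := w₁ t) (y := w₂ t) hp hp' (h.diam _ (h₂ (t + 1)) _ (h₁ (t + 1)))
  have a3 := mul_le_mul_of_nonneg_left a2 hlam
  have a4 := mul_le_mul_of_nonneg_left hc₁ (sub_nonneg.2 hp')
  have a5 := mul_le_mul_of_nonneg_left hc₂ hp
  have hZ := hn.Z_pos
  have hn0 := hn.n_pos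
  have a6 : lam * |combinerWeight f lam G D 2 n Z w₁ w₂ (t + 1) -
      combinerWeight f lam G D 2 n Z w₁ w₂ t| ≤
      3 * max (√lam) 1 * (5 / 8 * (√(n * Real.log (1 / Z)) / n) + Z / 7) := by
    calc _ ≤ max (√lam) 1 ^ 2 * (3 * (1 / max (√lam) 1) *
          (5 / 8 * (√(n * Real.log (1 / Z)) / n) + Z / 7)) := by
          gcongr
          exact a0
      _ = _ := by field_simp
  have a7 := mul_le_mul_of_nonneg_right a6 hD.le
  rw [combiner, combiner]
  linarith

/-- The reason for dividing the bits by max(√λ,1). In units of 3GD·max(√λ,1) a change of weight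
costs the left side; the right side is what the potential argument absorbs for m = 1/max(√λ,1). -/
theorem switching_coeff_le (lam : ℝ) :
    lam / (3 * max (√lam) 1) ≤ 1 / (3 * (1 / max (√lam) 1)) := by
  have hμ : (0 : ℝ) < max (√lam) 1 := lt_max_of_lt_right one_pos
  have hμ2 := le_sq_max_sqrt_one lam
  have : 1 / (3 * (1 / max (√lam) 1)) = max (√lam) 1 ^ 2 / (3 * max (√lam) 1) := by field_simp
  rw [this]
  gcongr

include h hlam h₁ h₂ in
theorem combiner_regret_le_first (hn : DnpParams n Z (1 / max (√lam) 1))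
    (hs₁ : ∀ t ∈ Finset.Icc 1 T, lam * ‖w₁ t - w₁ (t + 1)‖ ≤ 2 * D)
    (hs₂ : ∀ t ∈ Finset.Icc 1 T, lam * ‖w₂ t - w₂ (t + 1)‖ ≤ 2 * D) {r s : ℕ} (hr : 1 ≤ r)
    (hrs : r ≤ s) (hs : s ≤ T) (u : ℕ → E) :
    dynamicRegret f lam G (combiner f lam G D 2 n Z w₁ w₂) u r s ≤
      dynamicRegret f lam G w₁ u r s + 3 * G * D * max (√lam) 1 *
        (5 * √(n * Real.log (1 / Z)) + ((s : ℝ) - r + 1) * Z) := by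
  have hG := h.G_pos
  have hD := h.D_pos
  have hμ : (0 : ℝ) < max (√lam) 1 := lt_max_of_lt_right one_pos
  have hsum := hn.sum_neg_mul_le (h.abs_lossGap_le hlam h₁ h₂ hs₁ hs₂) (switching_coeff_le lam)
    hr hrs hs
  refine le_trans ?_ (add_le_add_right (mul_le_mul_of_nonneg_left hsum (by positivity)) _)
  unfold dynamicRegret
  rw [Finset.mul_sum, ← Finset.sum_add_distrib]
  refine Finset.sum_le_sum fun t ht => ?_
  rw [Finset.mem_Icc] at ht
  have a1 := h.totalLoss_combiner_le (n := n) (Z := Z) hlam h₁ h₂ (M := 2)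
    (Finset.mem_Icc.2 ⟨by omega, by omega⟩ : t ∈ _)
  unfold combinerWeight at a1
  have e : totalLoss f lam G w₂ t = totalLoss f lam G w₁ t - 3 * G * D * max (√lam) 1 *
      (lossGap f lam G D 2 w₁ w₂ t / max (√lam) 1) := by
    unfold lossGap
    field_simp
    ring
  rw [e] at a1
  generalize dnpPrediction n Z (fun j => lossGap f lam G D 2 w₁ w₂ j / max (√lam) 1) t = p at *
  generalize dnpPrediction n Z (fun j => lossGap f lam G D 2 w₁ w₂ j / max (√lam) 1) (t + 1) = q
    at *
  have e2 : 3 * G * D * max (√lam) 1 * (lam / (3 * max (√lam) 1) * |q - p|) =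
      lam * G * D * |q - p| := by field_simp
  rw [mul_add, e2]
  unfold totalLoss at a1
  linarith

include h hlam h₁ h₂ in
theorem combiner_regret_le_second (hn : DnpParams n Z (1 / max (√lam) 1))
    (hs₁ : ∀ t ∈ Finset.Icc 1 T, lam * ‖w₁ t - w₁ (t + 1)‖ ≤ 2 * D)
    (hs₂ : ∀ t ∈ Finset.Icc 1 T, lam * ‖w₂ t - w₂ (t + 1)‖ ≤ 2 * D) {r s : ℕ} (hr : 1 ≤ r)
    (hrs : r ≤ s) (hs : s ≤ T) (u : ℕ → E) :
    dynamicRegret f lam G (combiner f lam G D 2 n Z w₁ w₂) u r s ≤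
      dynamicRegret f lam G w₂ u r s + 3 * G * D * max (√lam) 1 *
        (5 * √(n * Real.log (1 / Z)) +
          ((s : ℝ) - r + 1) * (5 * (√(n * Real.log (1 / Z)) / n) + Z)) := by
  have hG := h.G_pos
  have hD := h.D_pos
  have hμ : (0 : ℝ) < max (√lam) 1 := lt_max_of_lt_right one_pos
  have hsum := hn.sum_one_sub_mul_le (h.abs_lossGap_le hlam h₁ h₂ hs₁ hs₂)
    (switching_coeff_le lam) hr hrs hs
  refine le_trans ?_ (add_le_add_right (mul_le_mul_of_nonneg_left hsum (by positivity)) _)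
  unfold dynamicRegret
  rw [Finset.mul_sum, ← Finset.sum_add_distrib]
  refine Finset.sum_le_sum fun t ht => ?_
  rw [Finset.mem_Icc] at ht
  have a1 := h.totalLoss_combiner_le (n := n) (Z := Z) hlam h₁ h₂ (M := 2)
    (Finset.mem_Icc.2 ⟨by omega, by omega⟩ : t ∈ _)
  unfold combinerWeight at a1
  have e : totalLoss f lam G w₁ t = totalLoss f lam G w₂ t + 3 * G * D * max (√lam) 1 *
      (lossGap f lam G D 2 w₁ w₂ t / max (√lam) 1) := by
    unfold lossGap
    field_simp
    ring
  rw [e] at a1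
  generalize dnpPrediction n Z (fun j => lossGap f lam G D 2 w₁ w₂ j / max (√lam) 1) t = p at *
  generalize dnpPrediction n Z (fun j => lossGap f lam G D 2 w₁ w₂ j / max (√lam) 1) (t + 1) = q
    at *
  have e2 : 3 * G * D * max (√lam) 1 * (lam / (3 * max (√lam) 1) * |q - p|) =
      lam * G * D * |q - p| := by field_simp
  rw [mul_add, e2]
  unfold totalLoss at a1
  linarith

end IsBoundedOCO
end SmoothedOCO

/-! ### Dyadic scales and the hierarchy of combiners. -/

namespace SmoothedOCO

theorem scale_one (T : ℕ) : scale T 1 = T := by simp [scale]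

theorem scale_eq_two_mul (T i : ℕ) : scale T i = 2 * scale T (i + 1) := by
  unfold scale
  have : (1 - (i : ℤ)) = (1 - ((i + 1 : ℕ) : ℤ)) + 1 := by push_cast; ring
  rw [this, zpow_add_one₀ (by norm_num)]
  ring

theorem scale_eq_div (T : ℕ) {i : ℕ} (hi : 1 ≤ i) : scale T i = T / 2 ^ (i - 1) := by
  induction i, hi using Nat.le_induction with
  | base => simp [scale]
  | succ i hi ih =>
    have h1 := scale_eq_two_mul T i
    obtain ⟨j, rfl⟩ := Nat.exists_eq_add_of_le' hi
    simp only [Nat.add_sub_cancel] at ih ⊢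
    rw [pow_succ, ← div_div, ← ih]
    linarith

theorem scale_antitone (T : ℕ) : Antitone (scale T) :=
  antitone_nat_of_succ_le fun i => by
    have h1 := scale_eq_two_mul T i
    have h2 : 0 ≤ scale T (i + 1) := by unfold scale; positivity
    linarith

theorem sqrt_scale_eq (T i : ℕ) : √(scale T i) = √2 * √(scale T (i + 1)) := by
  rw [scale_eq_two_mul, Real.sqrt_mul (by norm_num)]

theorem exists_scale_le {T K : ℕ} {q : ℝ} (hK : 1 ≤ K) (hq : scale T K ≤ q) (hT : q ≤ T) :
    ∃ i ∈ Finset.Icc 1 K, scale T i ≤ q ∧ q ≤ 2 * scale T i := by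
  induction K, hK using Nat.le_induction with
  | base =>
    refine ⟨1, by simp, hq, ?_⟩
    rw [scale_one] at *
    linarith [Nat.cast_nonneg (α := ℝ) T]
  | succ K hK ih =>
    rcases le_or_gt (scale T K) q with h | h
    · obtain ⟨i, hi, h2⟩ := ih h
      exact ⟨i, Finset.mem_Icc.2 ⟨(Finset.mem_Icc.1 hi).1, by
        have := (Finset.mem_Icc.1 hi).2; omega⟩, h2⟩
    · exact ⟨K + 1, Finset.mem_Icc.2 ⟨by omega, le_rfl⟩, hq, by
        rw [← scale_eq_two_mul]; exact h.le⟩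

theorem sqrt_mul_div_self {n : ℝ} (hn : 0 < n) (L : ℝ) : √(n * L) / n = √L / √n := by
  rw [Real.sqrt_mul hn.le]
  have h1 : √n * √n = n := Real.mul_self_sqrt hn.le
  have h2 : 0 < √n := Real.sqrt_pos.2 hn
  rw [div_eq_div_iff hn.ne' h2.ne']
  calc √n * √L * √n = √L * (√n * √n) := by ring
    _ = _ := by rw [h1]

theorem DnpParams.mul_sq_le {n Z μ : ℝ} (hμ : 0 < μ) (h : DnpParams n Z (1 / μ)) :
    32 * Real.log (1 / Z) * μ ^ 2 ≤ n := by
  have h1 := h.le_n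
  have e : (1 / μ) ^ 2 * n = n / μ ^ 2 := by rw [div_pow]; ring
  rwa [e, le_div_iff₀ (by positivity)] at h1

/-- The constant 177/1000 is an upper approximation of 1/√32. -/
theorem DnpParams.mul_ratio_le {n Z μ : ℝ} (hμ : 0 < μ) (h : DnpParams n Z (1 / μ)) :
    μ * (√(Real.log (1 / Z)) / √n) ≤ 177 / 1000 := by
  have hn := h.n_pos
  have h1 := h.mul_sq_le hμ
  have h2 := h.one_le_log
  refine le_of_sq_le_sq ?_ (by norm_num)
  rw [mul_pow, div_pow, Real.sq_sqrt (by linarith), Real.sq_sqrt hn.le, mul_div_assoc',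
    div_le_iff₀ hn]
  nlinarith

variable {E : Type*} [NormedAddCommGroup E] [InnerProductSpace ℝ E]

theorem smoothedOGD_one (W : Set E) (f : ℕ → E → ℝ) (grad : ℕ → E → E) (lam G D M Z : ℝ) (T : ℕ)
    (x₁ : ℕ → E) : smoothedOGD W f grad lam G D M Z T x₁ 1 = expert W grad lam G D T x₁ 1 := by
  rw [smoothedOGD, if_pos rfl]

theorem smoothedOGD_succ (W : Set E) (f : ℕ → E → ℝ) (grad : ℕ → E → E) (lam G D M Z : ℝ) (T : ℕ)
    (x₁ : ℕ → E) {i : ℕ} (hi : 1 ≤ i) :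
    smoothedOGD W f grad lam G D M Z T x₁ (i + 1) =
      combiner f lam G D M (scale T (i + 1)) Z (smoothedOGD W f grad lam G D M Z T x₁ i)
        (expert W grad lam G D T x₁ (i + 1)) := by
  rw [smoothedOGD, if_neg (by omega)]

namespace IsBoundedOCO

variable [CompleteSpace E] {W : Set E} {f : ℕ → E → ℝ} {grad : ℕ → E → E} {G D : ℝ} {T : ℕ}
  (h : IsBoundedOCO W f grad G D T)

include h in
theorem dynamicRegret_le_of_slow {lam C : ℝ} {w u : ℕ → E} (hw : ∀ t, w t ∈ W) {r s : ℕ}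
    (hr : 1 ≤ r) (hrs : r ≤ s) (hs : s ≤ T) (hu : ∀ t ∈ Finset.Icc r s, u t ∈ W)
    (hC : ∀ t ∈ Finset.Icc 1 T, lam * ‖w t - w (t + 1)‖ ≤ C * D) :
    dynamicRegret f lam G w u r s ≤ ((s : ℝ) - r + 1) * (G * D * (1 + C)) := by
  have hb : ∀ t ∈ Finset.Icc r s, f t (w t) + lam * G * ‖w t - w (t + 1)‖ - f t (u t) ≤
      (0 : ℝ) - 0 + G * D * (1 + C) := by
    intro t ht
    have ht' := Finset.mem_Icc.1 ht
    have htT : t ∈ Finset.Icc 1 T := Finset.mem_Icc.2 ⟨by omega, by omega⟩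
    have h1 := h.loss_sub_le htT (hw t) (hu t ht)
    have h2 := mul_le_mul_of_nonneg_left (hC t htT) h.G_pos.le
    linarith
  have := sum_le_of_forall_le (c := fun _ => 0) hrs hb
  simpa [dynamicRegret] using this

variable {lam Z : ℝ} {x₁ : ℕ → E} {K : ℕ}

include h in
theorem expert_mem {i : ℕ} (hx : x₁ i ∈ W) (t : ℕ) : expert W grad lam G D T x₁ i t ∈ W :=
  ogd_mem h.closed h.convex grad _ hx t

include h in
theorem smoothedOGD_mem (hx : ∀ i ∈ Finset.Icc 1 K, x₁ i ∈ W) {i : ℕ} (hi : 1 ≤ i) (hiK : i ≤ K)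
    (t : ℕ) : smoothedOGD W f grad lam G D 2 Z T x₁ i t ∈ W := by
  induction i, hi using Nat.le_induction with
  | base =>
    rw [smoothedOGD_one]
    exact h.expert_mem (hx 1 (Finset.mem_Icc.2 ⟨le_rfl, hiK⟩)) t
  | succ i hi ih =>
    rw [smoothedOGD_succ _ _ _ _ _ _ _ _ _ _ hi]
    exact combiner_mem h.convex f lam G D 2 _ Z (ih (by omega))
      (h.expert_mem (hx _ (Finset.mem_Icc.2 ⟨by omega, hiK⟩)) t)

variable (hlam : 0 ≤ lam) (hx : ∀ i ∈ Finset.Icc 1 K, x₁ i ∈ W)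
  (hn : ∀ i ∈ Finset.Icc 1 K, DnpParams (scale T i) Z (1 / max (√lam) 1))
  (hK : max (√lam) 1 * Z * K ≤ 1)
include h hlam hx hn

theorem expert_slow {i : ℕ} (hi : i ∈ Finset.Icc 1 K) {t : ℕ} (ht : t ∈ Finset.Icc 1 T) :
    lam * ‖expert W grad lam G D T x₁ i t - expert W grad lam G D T x₁ i (t + 1)‖ ≤ 1 / 8 * D := by
  refine (h.expert_sub_le hlam (hx i hi) ht).trans ?_
  have hD := h.D_pos
  have hμ : (0 : ℝ) < max (√lam) 1 := lt_max_of_lt_right one_pos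
  have hμ2 := le_sq_max_sqrt_one lam
  have h1 := (hn i hi).mul_sq_le hμ
  have h2 := (hn i hi).one_le_log
  have hn0 := (hn i hi).n_pos
  have h5 : 32 * lam ≤ scale T i := by nlinarith
  have h3 : 8 * lam ≤ √((1 + 2 * lam) * scale T i) :=
    Real.le_sqrt_of_sq_le (by nlinarith [mul_le_mul_of_nonneg_left h5 hlam])
  have h4 : 0 < √((1 + 2 * lam) * scale T i) := Real.sqrt_pos.2 (by positivity)
  refine mul_le_mul_of_nonneg_right ?_ hD.le
  rw [div_le_iff₀ h4]
  linarith

include hK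

/-- Induction over levels, stable because scales halve: a combiner adds 15/8 of the ratio term, and
(105/16)(√2/2) + 15/8 ≤ 105/16. The Z-terms merely add up, which is why their sum over K levels must
be assumed small. The bound 2 is what the next combiner needs for its bits. -/
theorem smoothedOGD_slow_aux {i : ℕ} (hi : 1 ≤ i) (hiK : i ≤ K) {t : ℕ}
    (ht : t ∈ Finset.Icc 1 T) :
    lam * ‖smoothedOGD W f grad lam G D 2 Z T x₁ i t -
      smoothedOGD W f grad lam G D 2 Z T x₁ i (t + 1)‖ ≤
      (1 / 8 + 105 / 16 * (max (√lam) 1 * (√(Real.log (1 / Z)) / √(scale T i))) +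
        3 / 7 * (max (√lam) 1 * Z * i)) * D ∧
    1 / 8 + 105 / 16 * (max (√lam) 1 * (√(Real.log (1 / Z)) / √(scale T i))) +
        3 / 7 * (max (√lam) 1 * Z * i) ≤ 2 := by
  have hD := h.D_pos
  have hμ : (0 : ℝ) < max (√lam) 1 := lt_max_of_lt_right one_pos
  refine ⟨?_, ?_⟩
  swap
  · have hn' := hn i (Finset.mem_Icc.2 ⟨hi, hiK⟩)
    have h1 := hn'.mul_ratio_le hμ
    have hZ := hn'.Z_pos
    have h2 : max (√lam) 1 * Z * i ≤ max (√lam) 1 * Z * K := by gcongr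
    linarith
  induction i, hi using Nat.le_induction generalizing t with
  | base =>
    rw [smoothedOGD_one]
    have h1 : 1 ∈ Finset.Icc 1 K := Finset.mem_Icc.2 ⟨le_rfl, hiK⟩
    have hZ := (hn 1 h1).Z_pos
    refine (h.expert_slow hlam hx hn h1 ht).trans ?_
    refine mul_le_mul_of_nonneg_right ?_ hD.le
    have : 0 ≤ 105 / 16 * (max (√lam) 1 * (√(Real.log (1 / Z)) / √(scale T 1))) := by positivity
    have : 0 ≤ 3 / 7 * (max (√lam) 1 * Z * (1 : ℕ)) := by positivity
    linarith
  | succ i hi ih =>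
    have hi1 : i + 1 ∈ Finset.Icc 1 K := Finset.mem_Icc.2 ⟨by omega, hiK⟩
    have hi0 : i ∈ Finset.Icc 1 K := Finset.mem_Icc.2 ⟨by omega, by omega⟩
    have hn' := hn _ hi1
    have hZ := hn'.Z_pos
    have hC2 : 1 / 8 + 105 / 16 * (max (√lam) 1 * (√(Real.log (1 / Z)) / √(scale T i))) +
        3 / 7 * (max (√lam) 1 * Z * i) ≤ 2 := by
      have h1 := (hn i hi0).mul_ratio_le hμ
      have h2 : max (√lam) 1 * Z * i ≤ max (√lam) 1 * Z * K := by
        have : i ≤ K := by omega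
        gcongr
      linarith
    have hC1 : 1 / 8 ≤ 1 / 8 + 105 / 16 * (max (√lam) 1 * (√(Real.log (1 / Z)) / √(scale T i))) +
        3 / 7 * (max (√lam) 1 * Z * i) := by
      have : 0 ≤ 105 / 16 * (max (√lam) 1 * (√(Real.log (1 / Z)) / √(scale T i))) := by positivity
      have : 0 ≤ 3 / 7 * (max (√lam) 1 * Z * i) := by positivity
      linarith
    have he : ∀ t ∈ Finset.Icc 1 T, _ := fun t ht => h.expert_slow hlam hx hn hi1 ht
    rw [smoothedOGD_succ _ _ _ _ _ _ _ _ _ _ hi]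
    refine (h.combiner_sub_le hlam (h.smoothedOGD_mem hx hi (by omega)) (h.expert_mem (hx _ hi1))
      hn' (fun t ht => (ih (by omega) ht).trans (by gcongr))
      (fun t ht => (he t ht).trans (by gcongr; norm_num)) ht (ih (by omega) ht)
      ((he t ht).trans (by gcongr))).trans ?_
    refine mul_le_mul_of_nonneg_right ?_ hD.le
    rw [sqrt_mul_div_self hn'.n_pos]
    have e : √(Real.log (1 / Z)) / √(scale T i) =
        (√(Real.log (1 / Z)) / √(scale T (i + 1))) * (√2 / 2) := by
      rw [sqrt_scale_eq T i]
      have h2 : (√2 : ℝ) * √2 = 2 := Real.mul_self_sqrt (by norm_num)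
      have h3 : 0 < √(scale T (i + 1)) := Real.sqrt_pos.2 hn'.n_pos
      field_simp
      linear_combination -√(Real.log (1 / Z)) * h2
    rw [e]
    have h2 : √2 ≤ 1.4143 := Real.sqrt_le_iff.2 ⟨by norm_num, by norm_num⟩
    have h3 : 0 ≤ max (√lam) 1 * (√(Real.log (1 / Z)) / √(scale T (i + 1))) := by positivity
    have h4 := mul_le_mul_of_nonneg_left h2 h3
    push_cast
    linarith

theorem smoothedOGD_slow {i : ℕ} (hi : 1 ≤ i) (hiK : i ≤ K) :
    ∀ t ∈ Finset.Icc 1 T, lam * ‖smoothedOGD W f grad lam G D 2 Z T x₁ i t -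
      smoothedOGD W f grad lam G D 2 Z T x₁ i (t + 1)‖ ≤ 2 * D := by
  intro t ht
  obtain ⟨h1, h2⟩ := h.smoothedOGD_slow_aux hlam hx hn hK hi hiK ht
  exact h1.trans (mul_le_mul_of_nonneg_right h2 h.D_pos.le)

/-- The output of every level from `i` on competes with the `i`-th expert. -/
theorem smoothedOGD_regret_le_expert {i k : ℕ} (hi : 1 ≤ i) (hik : i ≤ k) (hkK : k ≤ K) {r s : ℕ}
    (hr : 1 ≤ r) (hrs : r ≤ s) (hs : s ≤ T) (u : ℕ → E) :
    dynamicRegret f lam G (smoothedOGD W f grad lam G D 2 Z T x₁ k) u r s ≤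
      dynamicRegret f lam G (expert W grad lam G D T x₁ i) u r s + 3 * G * D * max (√lam) 1 *
        (5 * (√(scale T i) * √(Real.log (1 / Z))) +
          ((s : ℝ) - r + 1) * (5 * (√(Real.log (1 / Z)) / √(scale T i))) +
          ((s : ℝ) - r + 1) * (Z * k) +
          25 / 2 * ((√(scale T i) - √(scale T k)) * √(Real.log (1 / Z)))) := by
  have hG := h.G_pos
  have hD := h.D_pos
  have hμ : (0 : ℝ) < max (√lam) 1 := lt_max_of_lt_right one_pos
  have hτ : (0 : ℝ) < (s : ℝ) - r + 1 := by
    have : (r : ℝ) ≤ s := by exact_mod_cast hrs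
    linarith
  have hslow : ∀ i ∈ Finset.Icc 1 K, ∀ t ∈ Finset.Icc 1 T, lam *
      ‖expert W grad lam G D T x₁ i t - expert W grad lam G D T x₁ i (t + 1)‖ ≤ 2 * D :=
    fun i hi t ht => (h.expert_slow hlam hx hn hi ht).trans (by gcongr; norm_num)
  induction k, hik using Nat.le_induction with
  | base =>
    have hi0 : i ∈ Finset.Icc 1 K := Finset.mem_Icc.2 ⟨hi, hkK⟩
    have hn' := hn i hi0
    have hZ := hn'.Z_pos
    rw [sub_self, zero_mul, mul_zero, add_zero]
    -- Level 1 is the expert itself; at any other level the expert is the second learner, so the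
    -- comparison is with weight 1.
    rcases hi.eq_or_lt with rfl | hi2
    · rw [smoothedOGD_one]
      exact le_add_of_nonneg_right (by positivity)
    · obtain ⟨j, rfl⟩ := Nat.exists_eq_add_of_le' hi
      have hj : 1 ≤ j := by omega
      rw [smoothedOGD_succ _ _ _ _ _ _ _ _ _ _ hj]
      refine (h.combiner_regret_le_second hlam (h.smoothedOGD_mem hx hj (by omega))
        (h.expert_mem (hx _ hi0)) hn'
        (h.smoothedOGD_slow hlam hx hn hK hj (by omega)) (hslow _ hi0) hr hrs hs u).trans ?_
      refine add_le_add_right (mul_le_mul_of_nonneg_left ?_ (by positivity)) _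
      rw [sqrt_mul_div_self hn'.n_pos, Real.sqrt_mul hn'.n_pos.le, mul_add _ _ Z, ← add_assoc]
      gcongr
      refine le_mul_of_one_le_right hZ.le ?_
      exact_mod_cast hi
  | succ k hik ih =>
    have hk0 : k + 1 ∈ Finset.Icc 1 K := Finset.mem_Icc.2 ⟨by omega, hkK⟩
    have hk : 1 ≤ k := by omega
    have hn' := hn _ hk0
    rw [smoothedOGD_succ _ _ _ _ _ _ _ _ _ _ hk]
    have h1 := h.combiner_regret_le_first hlam (h.smoothedOGD_mem hx hk (by omega))
        (h.expert_mem (hx _ hk0)) hn'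
        (h.smoothedOGD_slow hlam hx hn hK hk (by omega)) (hslow _ hk0) hr hrs hs u
    refine h1.trans ((add_le_add_left (ih (by omega)) _).trans ?_)
    rw [add_assoc, ← mul_add]
    refine add_le_add_right (mul_le_mul_of_nonneg_left ?_ (by positivity)) _
    rw [Real.sqrt_mul hn'.n_pos.le, sqrt_scale_eq T k]
    -- A later level costs 5√(n^{(k+1)}L), which the telescoping term absorbs because (25/2)(√2 - 1)
    -- ≥ 5.
    have h2 : 1.4 ≤ √2 := Real.le_sqrt_of_sq_le (by norm_num)
    have h3 : 0 ≤ √(scale T (k + 1)) * √(Real.log (1 / Z)) := by positivity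
    have h4 := mul_le_mul_of_nonneg_left h2 h3
    push_cast
    linarith

end IsBoundedOCO
end SmoothedOCO

/-! ### Number of experts, tuning, and the final bound. -/

namespace SmoothedOCO

theorem max_sqrt_one_sq {lam : ℝ} (hlam : 0 ≤ lam) : max (√lam) 1 ^ 2 = max lam 1 := by
  rcases le_total lam 1 with h | h
  · rw [max_eq_right h, max_eq_right (Real.sqrt_le_one.2 h), one_pow]
  · rw [max_eq_left h, max_eq_left (Real.one_le_sqrt.2 h), Real.sq_sqrt hlam]

theorem one_le_numExperts (lam Z : ℝ) (T : ℕ) : 1 ≤ numExperts lam Z T := Nat.le_add_left _ _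

theorem scale_numExperts_lt {lam Z : ℝ} {T : ℕ} (hlam : 0 ≤ lam) (hT : 0 < T)
    (hL : 1 ≤ Real.log (1 / Z)) :
    scale T (numExperts lam Z T) < 64 * max (√lam) 1 ^ 2 * Real.log (1 / Z) := by
  rw [max_sqrt_one_sq hlam, scale_eq_div T (one_le_numExperts lam Z T), numExperts,
    Nat.add_sub_cancel]
  have hm : (0 : ℝ) < max lam 1 := lt_max_of_lt_right one_pos
  have hT' : (0 : ℝ) < T := by exact_mod_cast hT
  have h1 := Nat.lt_floor_add_one (Real.logb 2 ((T : ℝ) / (32 * max lam 1 * Real.log (1 / Z))))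
  rw [Real.logb_lt_iff_lt_rpow (by norm_num) (by positivity)] at h1
  set j := ⌊Real.logb 2 ((T : ℝ) / (32 * max lam 1 * Real.log (1 / Z)))⌋₊
  have e : (2 : ℝ) ^ ((j : ℝ) + 1) = 2 ^ j * 2 := by
    rw [Real.rpow_add_one (by norm_num), Real.rpow_natCast]
  rw [e, div_lt_iff₀ (by positivity)] at h1
  rw [div_lt_iff₀ (by positivity)]
  linarith

theorem le_scale_numExperts {lam Z : ℝ} {T : ℕ} (hlam : 0 ≤ lam) (hT : 0 < T)
    (hL : 1 ≤ Real.log (1 / Z)) (hK : 2 ≤ numExperts lam Z T) :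
    32 * max (√lam) 1 ^ 2 * Real.log (1 / Z) ≤ scale T (numExperts lam Z T) := by
  rw [max_sqrt_one_sq hlam, scale_eq_div T (one_le_numExperts lam Z T), numExperts,
    Nat.add_sub_cancel]
  have hm : (0 : ℝ) < max lam 1 := lt_max_of_lt_right one_pos
  have hT' : (0 : ℝ) < T := by exact_mod_cast hT
  -- With at least two experts the floor is not a truncated negative value, so it really bounds the
  -- logarithm from below.
  have h0 : ⌊Real.logb 2 ((T : ℝ) / (32 * max lam 1 * Real.log (1 / Z)))⌋₊ ≠ 0 := by
    unfold numExperts at hK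
    omega
  have h1 := (Nat.le_floor_iff' h0).1 le_rfl
  rw [Real.le_logb_iff_rpow_le (by norm_num) (by positivity), Real.rpow_natCast,
    le_div_iff₀ (by positivity)] at h1
  rw [le_div_iff₀ (by positivity)]
  linarith

theorem le_logb_of_le_scale {T K : ℕ} (hT : 0 < T) (hK : 1 ≤ K) (h : 2 ≤ scale T K) :
    (K : ℝ) ≤ Real.logb 2 T := by
  have hT' : (0 : ℝ) < T := by exact_mod_cast hT
  rw [Real.le_logb_iff_rpow_le (by norm_num) hT', Real.rpow_natCast]
  rw [scale_eq_div T hK, le_div_iff₀ (by positivity)] at h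
  obtain ⟨j, rfl⟩ := Nat.exists_eq_add_of_le' hK
  rw [Nat.add_sub_cancel] at h
  rw [pow_succ]
  linarith

theorem logb_two_le_two_mul_log {x : ℝ} (hx : 1 ≤ x) : Real.logb 2 x ≤ 2 * Real.log x := by
  have h1 := Real.log_two_gt_d9
  have h2 := Real.log_nonneg hx
  rw [Real.logb, div_le_iff₀ (by linarith)]
  nlinarith

theorem sqrt_one_add_two_mul_le (lam : ℝ) :
    √(1 + 2 * lam) ≤ √2 * √(1 + lam) := by
  rw [← Real.sqrt_mul (by norm_num)]
  exact Real.sqrt_le_sqrt (by linarith)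

/-- The bound on the regret of a gradient descent whose step size is tuned, up to a factor of two,
to the length and the path-length of the comparators. -/
theorem tuned_expert_bound {A lam n τ p : ℝ} (hA : 0 ≤ A) (hlam : 0 ≤ lam) (hn : 0 < n)
    (hτ : 0 < τ) (hp : 1 ≤ p) (h1 : n ≤ τ / p) (h2 : τ / p ≤ 2 * n) :
    √n ≤ √(τ * p) ∧ τ / √n ≤ √2 * √(τ * p) ∧
      A / 2 * √(1 + 2 * lam) * (√n * p + τ / √n) ≤ 2 * A * (√(1 + lam) * √(τ * p)) := by
  have hp0 : 0 < p := by linarith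
  rw [le_div_iff₀ hp0] at h1
  rw [div_le_iff₀ hp0] at h2
  have hw : 0 < √n := Real.sqrt_pos.2 hn
  have hsq : √n ^ 2 = n := Real.sq_sqrt hn.le
  have a1 : √n * p ≤ √(τ * p) := Real.le_sqrt_of_sq_le (by
    rw [mul_pow, hsq]
    nlinarith)
  have a2 : τ / √n ≤ √2 * √(τ * p) := by
    rw [← Real.sqrt_mul (by norm_num)]
    refine Real.le_sqrt_of_sq_le ?_
    rw [div_pow, hsq, div_le_iff₀ hn]
    nlinarith
  refine ⟨le_trans (le_mul_of_one_le_right hw.le hp) a1, a2, ?_⟩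
  have a3 := sqrt_one_add_two_mul_le lam
  have h4 : √2 * √2 = (2 : ℝ) := Real.mul_self_sqrt (by norm_num)
  have h5 : √2 ≤ (1.5 : ℝ) := Real.sqrt_le_iff.2 ⟨by norm_num, by norm_num⟩
  have h6 : 0 ≤ √(1 + lam) * √(τ * p) := by positivity
  calc A / 2 * √(1 + 2 * lam) * (√n * p + τ / √n)
      ≤ A / 2 * (√2 * √(1 + lam)) * (√(τ * p) + √2 * √(τ * p)) := by gcongr
    _ = A / 2 * ((√2 + √2 * √2) * (√(1 + lam) * √(τ * p))) := by ring
    _ ≤ A / 2 * (4 * (√(1 + lam) * √(τ * p))) := by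
      rw [h4]
      gcongr
      linarith
    _ = _ := by ring

/-- Write τ² = (τp)(τ/p): on short intervals a regret linear in τ already has the required
square-root form. -/
theorem le_mul_sqrt_of_lt {τ p c L : ℝ} (hτ : 0 < τ) (hp : 1 ≤ p) (hc : 0 ≤ c) (hL : 0 ≤ L)
    (h : τ / p ≤ 64 * c ^ 2 * L) : τ ≤ 8 * c * (√(τ * p) * √L) := by
  have hp0 : 0 < p := by linarith
  rw [div_le_iff₀ hp0] at h
  refine le_of_sq_le_sq ?_ (by positivity)
  rw [mul_pow, mul_pow, mul_pow, Real.sq_sqrt (by positivity), Real.sq_sqrt hL]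
  nlinarith

theorem regretBound_eq {lam G D τ P : ℝ} (hlam : 0 ≤ lam) (hτ : 0 ≤ τ) (hp : 0 ≤ 1 + 2 * P / D)
    (T : ℕ) :
    regretBound lam G D τ P T = 2 * (G * D) * (√(1 + lam) * √(τ * (1 + 2 * P / D))) +
      120 * (G * D) * max (√lam) 1 * (√(τ * (1 + 2 * P / D)) * √(Real.log T)) := by
  rw [regretBound, mul_assoc (1 + lam), Real.sqrt_mul (by linarith),
    Real.sqrt_mul (mul_nonneg hτ hp)]
  ring

/-- Both terms are compared with the same root, using log T ≥ 1 for the first and max(√λ,1)² ≤ 1+λ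
for the second. The coefficients add up to 122, and max(1, 2/D) absorbs the unit of path-length. -/
theorem regretBound_le {lam G D τ P : ℝ} {T : ℕ} (hG : 0 < G) (hD : 0 < D) (hlam : 0 ≤ lam)
    (hτ : 0 ≤ τ) (hP : 0 ≤ P) (hL : 1 ≤ Real.log T) :
    regretBound lam G D τ P T ≤
      122 * G * D * √(max 1 (2 / D)) * √((1 + lam) * τ * (1 + P) * Real.log T) := by
  have hp : 1 + 2 * P / D ≤ max 1 (2 / D) * (1 + P) := by
    have h1 : (1 : ℝ) ≤ max 1 (2 / D) := le_max_left _ _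
    have h2 : 2 / D ≤ max 1 (2 / D) := le_max_right _ _
    have h3 := mul_le_mul_of_nonneg_right h2 hP
    have h4 : 2 * P / D = 2 / D * P := by ring
    rw [h4]
    linarith
  have hp0 : 0 ≤ 1 + 2 * P / D := by positivity
  have hc : 0 ≤ max 1 (2 / D) := le_trans zero_le_one (le_max_left _ _)
  have hμ : max (√lam) 1 ^ 2 ≤ 1 + lam := by
    rw [max_sqrt_one_sq hlam]
    exact max_le (by linarith) (by linarith)
  have hμ0 : (0 : ℝ) ≤ max (√lam) 1 := le_trans zero_le_one (le_max_right _ _)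
  have e1 : √((1 + lam) * τ * (1 + 2 * P / D)) ≤
      √(max 1 (2 / D)) * √((1 + lam) * τ * (1 + P) * Real.log T) := by
    rw [← Real.sqrt_mul hc]
    refine Real.sqrt_le_sqrt ?_
    calc (1 + lam) * τ * (1 + 2 * P / D) ≤ (1 + lam) * τ * (max 1 (2 / D) * (1 + P)) := by gcongr
      _ ≤ (1 + lam) * τ * (max 1 (2 / D) * (1 + P)) * Real.log T :=
        le_mul_of_one_le_right (by positivity) hL
      _ = _ := by ring
  have e2 : max (√lam) 1 * √(τ * (1 + 2 * P / D) * Real.log T) ≤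
      √(max 1 (2 / D)) * √((1 + lam) * τ * (1 + P) * Real.log T) := by
    rw [← Real.sqrt_mul hc]
    refine Real.le_sqrt_of_sq_le ?_
    rw [mul_pow, Real.sq_sqrt (by positivity)]
    calc max (√lam) 1 ^ 2 * (τ * (1 + 2 * P / D) * Real.log T)
        ≤ (1 + lam) * (τ * (max 1 (2 / D) * (1 + P)) * Real.log T) := by gcongr
      _ = _ := by ring
  unfold regretBound
  calc _ = 2 * G * D * √((1 + lam) * τ * (1 + 2 * P / D)) +
        120 * G * D * (max (√lam) 1 * √(τ * (1 + 2 * P / D) * Real.log T)) := by ring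
    _ ≤ 2 * G * D * (√(max 1 (2 / D)) * √((1 + lam) * τ * (1 + P) * Real.log T)) +
        120 * G * D * (√(max 1 (2 / D)) * √((1 + lam) * τ * (1 + P) * Real.log T)) := by gcongr
    _ = _ := by ring

variable {E : Type*} [NormedAddCommGroup E] [InnerProductSpace ℝ E]

theorem pathLength_nonneg {E : Type*} [NormedAddCommGroup E] (u : ℕ → E) (r s : ℕ) :
    0 ≤ pathLength u r s := Finset.sum_nonneg fun _ _ => norm_nonneg _

namespace IsBoundedOCO

variable [CompleteSpace E] {W : Set E} {f : ℕ → E → ℝ} {grad : ℕ → E → E} {G D : ℝ} {T : ℕ}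
  (h : IsBoundedOCO W f grad G D T) {lam : ℝ} (hlam : 0 ≤ lam) {x₁ : ℕ → E}
  (hT : max (√lam * Real.logb 2 T) (Real.exp 1) ≤ (T : ℝ))
  {r s : ℕ} (hr : 1 ≤ r) (hrs : r ≤ s) (hs : s ≤ T) {u : ℕ → E}
  (hu : ∀ t ∈ Finset.Icc r s, u t ∈ W)

include h hlam hr hrs hs hu in
/-- With a single expert the horizon is so short that the trivial regret bound is good enough. -/
theorem expert_one_regret_le (hx : x₁ 1 ∈ W)
    (hT1 : (T : ℝ) ≤ 64 * max (√lam) 1 ^ 2 * Real.log T) (hL : 1 ≤ Real.log T) :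
    dynamicRegret f lam G (expert W grad lam G D T x₁ 1) u r s ≤
      regretBound lam G D ((s : ℝ) - r + 1) (pathLength u r s) T := by
  have hG := h.G_pos
  have hD := h.D_pos
  have hμ : (0 : ℝ) < max (√lam) 1 := lt_max_of_lt_right one_pos
  have hP := pathLength_nonneg u r s
  have hτ : (1 : ℝ) ≤ (s : ℝ) - r + 1 := by
    have : (r : ℝ) ≤ s := by exact_mod_cast hrs
    linarith
  have hτT : (s : ℝ) - r + 1 ≤ T := by
    have h1 : (1 : ℝ) ≤ r := by exact_mod_cast hr
    have h2 : (s : ℝ) ≤ T := by exact_mod_cast hs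
    linarith
  have hp : 1 ≤ 1 + 2 * pathLength u r s / D := le_add_of_nonneg_right (by positivity)
  have hreg := h.dynamicRegret_le_of_slow (h.expert_mem hx) hr hrs hs hu
    fun t ht => h.expert_sub_le hlam hx ht
  rw [scale_one] at hreg
  rw [regretBound_eq hlam (by linarith) (by linarith)]
  generalize (s : ℝ) - r + 1 = τ at *
  generalize 1 + 2 * pathLength u r s / D = p at *
  have hT0 : (0 : ℝ) < T := by linarith
  have a1 : τ ≤ 8 * max (√lam) 1 * (√(τ * p) * √(Real.log T)) :=
    le_mul_sqrt_of_lt (by linarith) hp hμ.le (by linarith)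
      ((div_le_self (by linarith) hp).trans (hτT.trans hT1))
  -- Slowness with constant 2 is not available here; the switching cost is read off from the step
  -- size and charged to the first term of the bound.
  have a2 : τ * (lam / √((1 + 2 * lam) * T)) ≤ √(1 + lam) * √(τ * p) := by
    rw [← Real.sqrt_mul (by linarith)]
    refine Real.le_sqrt_of_sq_le ?_
    rw [mul_pow, div_pow, Real.sq_sqrt (by positivity), mul_div_assoc',
      div_le_iff₀ (by positivity)]
    have b1 : lam ^ 2 ≤ (1 + lam) * (1 + 2 * lam) := by nlinarith
    have b2 : τ ^ 2 ≤ (τ * p) * T := by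
      have : τ ≤ p * T := hτT.trans (le_mul_of_one_le_left hT0.le hp)
      nlinarith
    calc τ ^ 2 * lam ^ 2 ≤ ((τ * p) * T) * ((1 + lam) * (1 + 2 * lam)) := by gcongr
      _ = _ := by ring
  have hGD : 0 < G * D := by positivity
  have a3 := mul_le_mul_of_nonneg_left a1 hGD.le
  have a4 := mul_le_mul_of_nonneg_left a2 hGD.le
  have a5 : 0 ≤ G * D * (√(1 + lam) * √(τ * p)) := by positivity
  have a6 : 0 ≤ G * D * (max (√lam) 1 * (√(τ * p) * √(Real.log T))) := by positivity
  linarith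

include h hlam hT hr hrs hs hu in
theorem smoothedOGD_regret_le
    (hx : ∀ i ∈ Finset.Icc 1 (numExperts lam (1 / T) T), x₁ i ∈ W) :
    dynamicRegret f lam G (smoothedOGD W f grad lam G D 2 (1 / T) T x₁
        (numExperts lam (1 / T) T)) u r s ≤
      regretBound lam G D ((s : ℝ) - r + 1) (pathLength u r s) T := by
  have hG := h.G_pos
  have hD := h.D_pos
  have hμ : (0 : ℝ) < max (√lam) 1 := lt_max_of_lt_right one_pos
  have hμ1 : (1 : ℝ) ≤ max (√lam) 1 := le_max_right _ _
  have hTe : Real.exp 1 ≤ T := (le_max_right _ _).trans hT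
  have hT0 : (0 : ℝ) < T := (Real.exp_pos 1).trans_le hTe
  have hT0' : 0 < T := by exact_mod_cast hT0
  have hT1 : (1 : ℝ) ≤ T := by exact_mod_cast hT0'
  have hL : 1 ≤ Real.log T := (Real.le_log_iff_exp_le hT0).2 hTe
  have hZ : Real.log (1 / (1 / (T : ℝ))) = Real.log T := by rw [one_div_one_div]
  have hK1 := one_le_numExperts lam (1 / T) T
  have hup := scale_numExperts_lt (Z := 1 / T) hlam hT0' (by rwa [hZ])
  rw [hZ] at hup
  -- A single expert covers the truncated floor, where the scale can be too small for `DnpParams`;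
  -- no combiner runs then.
  rcases hK1.eq_or_lt with hK | hK2
  · rw [← hK] at hup hx ⊢
    rw [smoothedOGD_one]
    rw [scale_one] at hup
    exact h.expert_one_regret_le hlam hr hrs hs hu (hx 1 (by simp)) hup.le hL
  have hlow := le_scale_numExperts (Z := 1 / T) hlam hT0' (by rwa [hZ]) hK2
  rw [hZ] at hlow
  generalize numExperts lam (1 / T) T = K at *
  have hscale : 2 ≤ scale T K := by
    have : (1 : ℝ) ≤ max (√lam) 1 ^ 2 := one_le_pow₀ hμ1
    nlinarith
  have hKlog := le_logb_of_le_scale hT0' hK1 hscale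
  have hn : ∀ i ∈ Finset.Icc 1 K, DnpParams (scale T i) (1 / T) (1 / max (√lam) 1) := by
    intro i hi
    refine ⟨by positivity, by rwa [hZ], by positivity, (div_le_one hμ).2 hμ1, ?_⟩
    rw [hZ, div_pow, one_pow, one_div_mul_eq_div, le_div_iff₀ (by positivity)]
    have := scale_antitone T (Finset.mem_Icc.1 hi).2
    linarith
  -- The assumption T ≥ √λ·log₂T serves only here, to keep the Z-terms of all levels bounded.
  have hKZ : max (√lam) 1 * (1 / T) * K ≤ 1 := by
    rw [mul_one_div, div_mul_eq_mul_div, div_le_one hT0, max_mul_of_nonneg _ _ (by positivity)]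
    refine max_le ?_ ?_
    · refine le_trans ?_ ((le_max_left _ _).trans hT)
      gcongr
    · rw [one_mul]
      refine hKlog.trans ?_
      rw [Real.logb_le_iff_le_rpow (by norm_num) hT0, Real.rpow_natCast]
      exact_mod_cast Nat.lt_two_pow_self.le
  have hP := pathLength_nonneg u r s
  have hτ : (1 : ℝ) ≤ (s : ℝ) - r + 1 := by
    have : (r : ℝ) ≤ s := by exact_mod_cast hrs
    linarith
  have hτT : (s : ℝ) - r + 1 ≤ T := by
    have h1 : (1 : ℝ) ≤ r := by exact_mod_cast hr
    have h2 : (s : ℝ) ≤ T := by exact_mod_cast hs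
    linarith
  have hp : 1 ≤ 1 + 2 * pathLength u r s / D := le_add_of_nonneg_right (by positivity)
  have hGD : 0 < G * D := by positivity
  rw [regretBound_eq hlam (by linarith) (by linarith)]
  -- Below the smallest scale no expert is tuned to the interval, and the cost of at most 3GD per
  -- round gives the coefficient 24. Otherwise some expert is tuned within a factor of two.
  rcases lt_or_ge (((s : ℝ) - r + 1) / (1 + 2 * pathLength u r s / D)) (scale T K) with hq | hq
  · have hreg := h.dynamicRegret_le_of_slow (h.smoothedOGD_mem (lam := lam) (Z := 1 / T) hx hK1
      le_rfl) hr hrs hs hu (h.smoothedOGD_slow hlam hx hn hKZ hK1 le_rfl)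
    generalize (s : ℝ) - r + 1 = τ at *
    generalize 1 + 2 * pathLength u r s / D = p at *
    have a1 : τ ≤ 8 * max (√lam) 1 * (√(τ * p) * √(Real.log T)) :=
      le_mul_sqrt_of_lt (by linarith) hp hμ.le (by linarith) (hq.trans hup).le
    have a3 := mul_le_mul_of_nonneg_left a1 hGD.le
    have a5 : 0 ≤ G * D * (√(1 + lam) * √(τ * p)) := by positivity
    have a6 : 0 ≤ G * D * (max (√lam) 1 * (√(τ * p) * √(Real.log T))) := by positivity
    linarith
  · obtain ⟨i, hi, hq1, hq2⟩ := exists_scale_le hK1 hq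
      ((div_le_self (by linarith) hp).trans hτT)
    have hi' := Finset.mem_Icc.1 hi
    have hreg := h.smoothedOGD_regret_le_expert hlam hx hn hKZ hi'.1 hi'.2 le_rfl hr hrs hs u
    have hexp := h.expert_regret_le hlam (hx i hi) hr hrs hs hu
    rw [hZ] at hreg
    generalize (s : ℝ) - r + 1 = τ at *
    generalize 1 + 2 * pathLength u r s / D = p at *
    obtain ⟨b1, b2, b3⟩ := tuned_expert_bound hGD.le hlam (hn i hi).n_pos (by linarith) hp hq1 hq2
    have hl : 0 ≤ √(Real.log T) := Real.sqrt_nonneg _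
    have hy : 0 ≤ √(τ * p) := Real.sqrt_nonneg _
    have hk : 0 ≤ √(scale T K) := Real.sqrt_nonneg _
    have h5 : √2 ≤ (1.5 : ℝ) := Real.sqrt_le_iff.2 ⟨by norm_num, by norm_num⟩
    have c1 : √(scale T i) * √(Real.log T) ≤ √(τ * p) * √(Real.log T) := by gcongr
    have c2 : τ * (√(Real.log T) / √(scale T i)) ≤ 1.5 * (√(τ * p) * √(Real.log T)) := by
      calc τ * (√(Real.log T) / √(scale T i)) = τ / √(scale T i) * √(Real.log T) := by ring
        _ ≤ (1.5 * √(τ * p)) * √(Real.log T) := by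
          gcongr
          exact b2.trans (by gcongr)
        _ = _ := by ring
    have c3 : τ * (1 / T * K) ≤ 2 * (√(τ * p) * √(Real.log T)) := by
      have d1 : (K : ℝ) ≤ 2 * Real.log T := hKlog.trans (logb_two_le_two_mul_log hT1)
      have d2 : τ * Real.log T ≤ T * (√(τ * p) * √(Real.log T)) := by
        rw [← Real.sqrt_mul (by nlinarith)]
        refine le_of_sq_le_sq ?_ (by positivity)
        rw [mul_pow, mul_pow, Real.sq_sqrt (by positivity)]
        have d3 : Real.log T ≤ T := Real.log_le_self hT0.le
        calc τ ^ 2 * Real.log T ^ 2 = (τ * τ) * (Real.log T * Real.log T) := by ring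
          _ ≤ (T * (τ * p)) * (T * Real.log T) := by
            gcongr
            exact le_mul_of_one_le_right (by linarith) hp
          _ = _ := by ring
      calc τ * (1 / T * K) ≤ τ * (1 / T * (2 * Real.log T)) := by gcongr
        _ = 2 * (τ * Real.log T) / T := by ring
        _ ≤ 2 * (√(τ * p) * √(Real.log T)) := by
          rw [div_le_iff₀ hT0]
          linarith
    have c4 : (√(scale T i) - √(scale T K)) * √(Real.log T) ≤ √(τ * p) * √(Real.log T) := by
      gcongr
      linarith
    -- The contributions 5, 7.5, 2 and 12.5 sum to 27; rounding up to 40 gives 3·40 = 120.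
    have c5 : 5 * (√(scale T i) * √(Real.log T)) + τ * (5 * (√(Real.log T) / √(scale T i))) +
        τ * (1 / T * K) + 25 / 2 * ((√(scale T i) - √(scale T K)) * √(Real.log T)) ≤
        40 * (√(τ * p) * √(Real.log T)) := by
      have : 0 ≤ √(τ * p) * √(Real.log T) := by positivity
      linarith
    have c6 := mul_le_mul_of_nonneg_left c5 (show 0 ≤ 3 * G * D * max (√lam) 1 by positivity)
    linarith

end IsBoundedOCO
end SmoothedOCO

theorem mainTheorem4 (G D : ℝ) (hG : 0 < G) (hD : 0 < D) :
    ∃ C : ℝ, ∀ (E : Type*) [NormedAddCommGroup E] [InnerProductSpace ℝ E] [CompleteSpace E]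
      (W : Set E) (f : ℕ → E → ℝ) (grad : ℕ → E → E) (lam : ℝ) (T : ℕ) (x₁ : ℕ → E),
      -- the domain: closed, convex, of diameter at most `D`
      IsClosed W → Convex ℝ W → (∀ w ∈ W, ∀ w' ∈ W, ‖w - w'‖ ≤ D) →
      -- convex losses on `W` with gradients bounded by `G`
      (∀ t ∈ Finset.Icc 1 T, ConvexOn ℝ W (f t)) →
      (∀ t ∈ Finset.Icc 1 T, ∀ w ∈ W, HasGradientWithinAt (f t) (grad t w) W w) →
      (∀ t ∈ Finset.Icc 1 T, ∀ w ∈ W, ‖grad t w‖ ≤ G) →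
      0 ≤ lam → max (√lam * Real.logb 2 T) (Real.exp 1) ≤ (T : ℝ) →
      -- arbitrary starting points of the experts
      (∀ i ∈ Finset.Icc 1 (SmoothedOCO.numExperts lam (1 / T) T), x₁ i ∈ W) →
      ∀ (r s : ℕ), 1 ≤ r → r ≤ s → s ≤ T →
      ∀ u : ℕ → E, (∀ t ∈ Finset.Icc r s, u t ∈ W) →
        SmoothedOCO.dynamicRegret f lam G
            (SmoothedOCO.smoothedOGD W f grad lam G D 2 (1 / T) T x₁
              (SmoothedOCO.numExperts lam (1 / T) T)) u r s ≤
          SmoothedOCO.regretBound lam G D ((s : ℝ) - r + 1) (SmoothedOCO.pathLength u r s) T ∧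
        SmoothedOCO.regretBound lam G D ((s : ℝ) - r + 1) (SmoothedOCO.pathLength u r s) T ≤
          C * √((1 + lam) * ((s : ℝ) - r + 1) * (1 + SmoothedOCO.pathLength u r s) *
            Real.log T) := by
  refine ⟨122 * G * D * √(max 1 (2 / D)), ?_⟩
  intro E _ _ _ W f grad lam T x₁ hcl hW hdiam hconv hgrad hbound hlam hT hx r s hr hrs hs u hu
  have h : SmoothedOCO.IsBoundedOCO W f grad G D T :=
    ⟨hG, hD, hcl, hW, hdiam, hconv, hgrad, hbound⟩
  refine ⟨h.smoothedOGD_regret_le hlam hT hr hrs hs hu hx, ?_⟩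
  have hTe : Real.exp 1 ≤ T := (le_max_right _ _).trans hT
  have hτ : (0 : ℝ) ≤ (s : ℝ) - r + 1 := by
    have : (r : ℝ) ≤ s := by exact_mod_cast hrs
    linarith
  exact SmoothedOCO.regretBound_le hG hD hlam hτ (SmoothedOCO.pathLength_nonneg u r s)
    ((Real.le_log_iff_exp_le ((Real.exp_pos 1).trans_le hTe)).2 hTe)
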